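/- Let $k$ machines hold samples $S_1,\dots,S_k$ (finite lists of elements of a finite universe; the data may be spread over the machines in any way, in particular evenly) with at most $n\ge 3$ items in total. Let $d$ be the number of distinct elements of the union of the samples (with multiplicities), $f_1$ the number of elements that occur exactly once in it, and $f_1^{(j)}$ the number of these that lie in $S_j$. All machines share fully random hash functions. HyperLogLog$(\delta,n)$ with relative error $\varepsilon_d$ is the following mergeable sketch: $\lceil a\log(1/\delta)\rceil$ independent copies of $m=\lceil a/\varepsilon_d^2\rceil$ registers; in each copy an item is hashed to a register and to $\lceil\log_2 n\rceil$ random bits, and the register keeps the maximal position of the first 1-bit; sketches are merged by registerwise maxima; a copy with $V\ge m/4$ empty registers is estimated by linear counting, $m\log(m/V)$, any other copy by the harmonic mean of the $2^{M_j}$ ($M_j$ the register values) with its bias removed (the estimate is the largest $N\le n$ for which the expectation of $\sum_j 2^{-M_j}$ on $N$ distinct items is at least the observed value); the estimate of the sketch is the median over the copies. Protocol: machine $j$ sends a sketch of its distinct elements and a sketch of the elements that occur exactly once in $S_j$. The master merges the first sketches pairwise, level by level, into a binary tree while a level has more than two sketches; for every $j$ it obtains from the tree the sketch $B_j$ of all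 machines except $j$ (merging one sibling per level and the remaining roots), and it merges the second sketch of machine $j$ into $B_j$, which gives $B_j'$. It returns $\hat f_1=\sum_j\hat f_1^{(j)}$ with $\hat f_1^{(j)}=\mathrm{est}(B_j')-\mathrm{est}(B_j)$. There are absolute constants $a,C>0$ such that for all $\varepsilon_d\in(0,1)$, $\delta\in(0,1/2]$, $n\ge 3$, $k$ and all samples as above: 1. for every fixed set of at most $n$ elements the estimate of its sketch has relative error at most $\varepsilon_d$ with probability at least $1-\delta$; 2. if $f_1\ge c\,d$ with $c>0$, then with probability at least $1-2k\delta$ both $$|\hat f_1^{(j)}-f_1^{(j)}|\le\frac{2\varepsilon_d}{c}f_1\ \text{ for every } j,\qquad |\hat f_1-f_1|\le\frac{2k\varepsilon_d}{c}f_1 ;$$ 3. every machine sends exactly two sketches, and the total communication is at most $C\,\frac{k}{\varepsilon_d^2}\log(1/\delta)\log\log n$ bits; 4. the master uses at most $C\,k\log k$ merge operations (for $k\ge 2$) and creates at most $C\,k$ further sketches. -/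

import Mathlib

open Finset

noncomputable section

/-! ### Probability over a finite uniform space -/

/-- Probability of the event `P` when `ω` is uniform on the finite type `Ω`. -/
def uniformProb {Ω : Type*} [Fintype Ω] (P : Ω → Prop) : ℝ :=
  open Classical in ((univ.filter P).card : ℝ) / (Fintype.card Ω : ℝ)

/-- Expectation of `X` when `ω` is uniform on the finite type `Ω`. -/
def uniformMean {Ω : Type*} [Fintype Ω] (X : Ω → ℝ) : ℝ :=
  (∑ ω, X ω) / (Fintype.card Ω : ℝ)

/-! ### HyperLogLog -/

/-- Parameters of a HyperLogLog sketch with the median trick: the number `m` of registers of one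
copy, the number `R` of independent copies, the number `L` of hash bits from which the rank of an
item is read, and the largest cardinality `n` that has to be estimated. -/
structure HLL where
  m : ℕ
  R : ℕ
  L : ℕ
  n : ℕ

namespace HLL

/-- Hash values of one copy: a register and a string of `L` bits. -/
abbrev Cell (p : HLL) : Type := Fin p.m × (Fin p.L → Bool)

/-- The hash functions of all copies. Uniform on this type: the copies are independent, and each
one hashes the elements of the universe `U` independently and uniformly. They are shared by all
machines. -/
abbrev Hash (p : HLL) (U : Type*) : Type _ := Fin p.R → U → p.Cell

/-- Position (counted from 1) of the first 1-bit; `L + 1` if there is none. -/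
def rank {L : ℕ} (w : Fin L → Bool) : ℕ := (List.ofFn w).idxOf true + 1

/-- The registers of one copy. -/
abbrev Registers (p : HLL) : Type := Fin p.m → ℕ

/-- Process one item: the register selected by the hash value keeps the maximal rank seen. -/
def insertItem {p : HLL} {V : Type*} (g : V → p.Cell) (M : p.Registers) (v : V) : p.Registers :=
  Function.update M (g v).1 (max (M (g v).1) (rank (g v).2))

/-- The registers of one copy after a single pass over a stream. -/
def scan {p : HLL} {V : Type*} (g : V → p.Cell) (l : List V) : p.Registers :=
  l.foldl (insertItem g) (fun _ => 0)

/-- The denominator `∑ⱼ 2^(-Mⱼ)` of the harmonic mean in HyperLogLog. -/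
def harmonicSum {p : HLL} (M : p.Registers) : ℝ := ∑ j, ((2 : ℝ) ^ (M j))⁻¹

/-- The expected denominator of the harmonic mean after a stream with `N` distinct items. -/
def expectedHarmonicSum (p : HLL) (N : ℕ) : ℝ :=
  uniformMean (fun g : Fin N → p.Cell => harmonicSum (scan g (List.finRange N)))

/-- The HyperLogLog estimate of one copy. Small range: linear counting, `m log (m / V)`, where `V`
is the number of empty registers. Otherwise: the harmonic mean estimate. The raw estimate
`α m² / ∑ⱼ 2^(-Mⱼ)` is a decreasing function of the denominator; its bias is removed by inverting
the exact expectation of the denominator (which decreases with the number of distinct items). -/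
def estimateCopy (p : HLL) (M : p.Registers) : ℝ :=
  let V : ℕ := (univ.filter (fun j => M j = 0)).card
  open Classical in
  if p.m ≤ 4 * V then (p.m : ℝ) * Real.log ((p.m : ℝ) / (V : ℝ))
  else ((Nat.findGreatest (fun N => harmonicSum M ≤ p.expectedHarmonicSum N) p.n : ℕ) : ℝ)

/-- The median of finitely many real numbers (for an even number, the upper median). -/
def median {R : ℕ} (x : Fin R → ℝ) : ℝ :=
  ((List.ofFn x).insertionSort (· ≤ ·)).getD (R / 2) 0

/-- A sketch: the registers of all copies. -/
abbrev Sketch (p : HLL) : Type := Fin p.R → p.Registers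

/-- The sketch of the empty stream. -/
def emptySketch (p : HLL) : p.Sketch := fun _ _ => 0

/-- The sketch of a stream. -/
def sketch (p : HLL) {U : Type*} (h : p.Hash U) (l : List U) : p.Sketch := fun r => scan (h r) l

/-- Sketches are merged by taking the maximum of each register. -/
def merge (p : HLL) (s t : p.Sketch) : p.Sketch := fun r j => max (s r j) (t r j)

/-- The estimate of the number of distinct items: the median of the estimates of the copies. -/
def estimate (p : HLL) (s : p.Sketch) : ℝ := median (fun r => p.estimateCopy (s r))

/-- Number of bits of one register, whose values are `0, …, L + 1`. -/
def registerBits (p : HLL) : ℕ := Nat.clog 2 (p.L + 2)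

/-- A sketch as a string of bits: the binary digits of all registers, one after the other. -/
def encode (p : HLL) (s : p.Sketch) : List Bool :=
  List.ofFn (fun t : Fin (p.R * (p.m * p.registerBits)) =>
    let r := (finProdFinEquiv.symm t).1
    let j := (finProdFinEquiv.symm (finProdFinEquiv.symm t).2).1
    let i := (finProdFinEquiv.symm (finProdFinEquiv.symm t).2).2
    (s r j).testBit i)

/-- Read a sketch from a string of bits. -/
def decode (p : HLL) (b : List Bool) : p.Sketch := fun r j =>
  Nat.ofBits (fun i : Fin p.registerBits =>
    b.getD (finProdFinEquiv (r, finProdFinEquiv (j, i)) : Fin (p.R * (p.m * p.registerBits))) false)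

/-- HyperLogLog(`δ`, `n`) for relative error `ε`: `⌈a / ε²⌉` registers, the median of
`⌈a log (1 / δ)⌉` copies, and `⌈log₂ n⌉` hash bits for the ranks. -/
def ofError (a ε δ : ℝ) (n : ℕ) : HLL where
  m := ⌈a / ε ^ 2⌉₊
  R := ⌈a * Real.log (1 / δ)⌉₊
  L := Nat.clog 2 n
  n := n

end HLL

end

/-! ### The two algorithms of the master node

They use sketches of type `α` through `merge` only; the cost counts the merge operations and the
sketches that the master creates. -/

/-- Cost counters. -/
structure Cost where
  merges : ℕ
  sketches : ℕ

/-- Computations that count their cost. -/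
abbrev Counted (β : Type) : Type := StateM Cost β

/-- Create a new sketch with the content `s`. -/
def newSketch {α : Type} (s : α) : Counted α := fun c =>
  (s, { c with sketches := c.sketches + 1 })

/-- Merge `t` into `s`. -/
def mergeOp {α : Type} (merge : α → α → α) (s t : α) : Counted α := fun c =>
  (merge s t, { c with merges := c.merges + 1 })

/-- One round of pre-merging: the sketches with numbers `2 i` and `2 i + 1` are merged. A last
sketch without a partner is left out. -/
def preMergeLevel {α : Type} (merge : α → α → α) : List α → Counted (List α)
  | s :: t :: rest => do
      let temp ← newSketch s
      let temp ← mergeOp merge temp t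
      let out ← preMergeLevel merge rest
      return temp :: out
  | _ => return []

/-- Rounds of pre-merging as long as the last level has more than two sketches; the result is the
list of all levels. `fuel` bounds the number of rounds. -/
def preMergeLoop {α : Type} (merge : α → α → α) : ℕ → List α → Counted (List (List α))
  | 0, level => return [level]
  | fuel + 1, level =>
      if 2 < level.length then do
        let next ← preMergeLevel merge level
        let levels ← preMergeLoop merge fuel next
        return level :: levels
      else return [level]

/-- Construction of the pre-merged sketches (each round at least halves the number of sketches, so
the number of machines bounds the number of rounds). -/
def preMerge {α : Type} (merge : α → α → α) (ndv : List α) : Counted (List (List α)) :=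
  preMergeLoop merge ndv.length ndv

/-- The value of `index XOR 1` (level 0) or `Next` (higher levels) that is used at level `l`. -/
def siblingAt (index : ℕ) : ℕ → ℕ
  | 0 => index ^^^ 1
  | l + 1 => (siblingAt index l / 2) ^^^ 1

/-- The positions (level, number) of pre-merged sketches visited from the bottom to the top. -/
def pathNodes (height index : ℕ) : List (ℕ × ℕ) :=
  (List.range height).map (fun l => (l, siblingAt index l))

/-- All positions of pre-merged sketches. -/
def allNodes {α : Type} (pm : List (List α)) : List (ℕ × ℕ) :=
  (List.range pm.length).flatMap (fun l =>
    (List.range (pm.getD l []).length).map (fun i => (l, i)))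

/-- The remaining positions: not merged yet, not containing machine `index` (the sketch with number
`i` of level `l` contains the machines `i * 2^l, …, (i + 1) * 2^l - 1`), and not part of a
pre-merged sketch of the next level. -/
def restNodes {α : Type} (pm : List (List α)) (index : ℕ) : List (ℕ × ℕ) :=
  (allNodes pm).filter (fun v =>
    v ∉ pathNodes pm.length index ∧ index / 2 ^ v.1 ≠ v.2 ∧
      ¬ (v.2 / 2 < (pm.getD (v.1 + 1) []).length))

/-- Merge the pre-merged sketches at the given positions into `B`; positions outside the table are
skipped. -/
def mergeNodes {α : Type} (merge : α → α → α) (pm : List (List α)) (B : α)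
    (nodes : List (ℕ × ℕ)) : Counted α :=
  nodes.foldlM (fun B v =>
    match (pm.getD v.1 [])[v.2]? with
    | some s => mergeOp merge B s
    | none => pure B) B

/-- The sketch `B` of all machines except machine `index`. -/
def mergeOthers {α : Type} (merge : α → α → α) (empty : α) (pm : List (List α)) (index : ℕ) :
    Counted α := do
  let B ← newSketch empty
  let B ← mergeNodes merge pm B (pathNodes pm.length index)
  mergeNodes merge pm B (restNodes pm index)

noncomputable section

/-- The body of the main loop: the change of the estimate of `f₁` due to machine `index`. -/
def estimateMachine {α : Type} (merge : α → α → α) (empty : α) (est : α → ℝ)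
    (pm : List (List α)) (f1Sketch : List α) (index : ℕ) : Counted ℝ := do
  let B ← mergeOthers merge empty pm index
  let B' ← mergeOp merge B (f1Sketch.getD index empty)
  return est B' - est B

/-- The main loop: the contributions of all machines to the estimate of `f₁`. -/
def estimateMachines {α : Type} (merge : α → α → α) (empty : α) (est : α → ℝ)
    (pm : List (List α)) (f1Sketch : List α) (k : ℕ) : Counted (List ℝ) :=
  (List.range k).mapM (estimateMachine merge empty est pm f1Sketch)

/-! ### The distributed protocol -/

/-- What a machine with sample `s` sends: the sketch of its distinct items and the sketch of the
items that occur exactly once in its sample, as strings of bits. -/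
def message (p : HLL) {U : Type*} [DecidableEq U] (h : p.Hash U) (s : List U) :
    List (List Bool) :=
  [p.encode (p.sketch h s), p.encode (p.sketch h (s.filter (fun u => s.count u = 1)))]

/-- The master node: it decodes the messages, pre-merges the sketches and runs the main loop. -/
def master (p : HLL) (msgs : List (List (List Bool))) : Counted (List ℝ) := do
  let ndvSketch := msgs.map (fun w => p.decode (w.getD 0 []))
  let f1Sketch := msgs.map (fun w => p.decode (w.getD 1 []))
  let pm ← preMerge p.merge ndvSketch
  estimateMachines p.merge p.emptySketch p.estimate pm f1Sketch msgs.length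

/-- A run of the protocol on the samples `S 0, …, S (k - 1)` with hash functions `h`: the
contributions of the machines and the cost of the master. -/
def runProtocol (p : HLL) {U : Type*} [DecidableEq U] (h : p.Hash U) {k : ℕ}
    (S : Fin k → List U) : List ℝ × Cost :=
  master p (List.ofFn (fun j => message p h (S j))) ⟨0, 0⟩

/-- The estimate of `f₁` returned by the protocol. -/
def f1Estimate (p : HLL) {U : Type*} [DecidableEq U] (h : p.Hash U) {k : ℕ}
    (S : Fin k → List U) : ℝ :=
  (runProtocol p h S).1.sum

/-- The part of the estimate of `f₁` due to machine `j`. -/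
def f1EstimateOf (p : HLL) {U : Type*} [DecidableEq U] (h : p.Hash U) {k : ℕ}
    (S : Fin k → List U) (j : Fin k) : ℝ :=
  (runProtocol p h S).1.getD j 0

/-- The total number of bits sent by the machines. -/
def communication (p : HLL) {U : Type*} [DecidableEq U] (h : p.Hash U) {k : ℕ}
    (S : Fin k → List U) : ℕ :=
  ∑ j, ((message p h (S j)).map List.length).sum

end

/-! ### Frequencies of frequencies of the union of the samples -/

/-- The number of occurrences of `u` in all samples together. -/
def totalFreq {U : Type*} [DecidableEq U] {k : ℕ} (S : Fin k → List U) (u : U) : ℕ :=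
  ∑ j, (S j).count u

/-- `fᵢ`: the number of elements that occur exactly `i` times in all samples together. -/
def freqOfFreq {U : Type*} [Fintype U] [DecidableEq U] {k : ℕ} (S : Fin k → List U) (i : ℕ) : ℕ :=
  (univ.filter (fun u => totalFreq S u = i)).card

/-- `d`: the number of distinct elements of all samples together. -/
def numDistinct {U : Type*} [Fintype U] [DecidableEq U] {k : ℕ} (S : Fin k → List U) : ℕ :=
  (univ.filter (fun u => totalFreq S u ≠ 0)).card

/-- The number of elements that occur exactly once in all samples together, namely in the sample
of machine `j`. -/
def numUniqueOf {U : Type*} [Fintype U] [DecidableEq U] {k : ℕ} (S : Fin k → List U)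
    (j : Fin k) : ℕ :=
  (univ.filter (fun u => totalFreq S u = 1 ∧ u ∈ S j)).card

/-! The accuracy of one copy is a second-moment argument. A register stays at or below `r` exactly
when every item avoids a certain set of hash values, so after `D` distinct items this has
probability `(1 - q) ^ D`. For two registers these sets are disjoint, and `1 - (q + q') ≤ (1 - q) *
(1 - q')` makes the two events negatively correlated. Covariances can therefore be dropped from the
variance of the harmonic sum; the variance of the number of empty registers is bounded from the same
exact formulas. Chebyshev's inequality keeps both statistics near their means, and both means can be
inverted stably: by a logarithm for few items (`linear_counting_error`), and for many items because
one dyadic scale already makes the mean of the harmonic sum react to a relative change of the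
cardinality (`le_registerMean_sub`). With `m ≥ 10 ^ 8 / ε ^ 2` a copy fails with probability at most
`1 / 16` (`uniformProb_estimateCopy_le`), and the median over the copies fails with exponentially
small probability (`uniformProb_half_bad_le`).

The work of the master is deterministic. A sketch depends only on the set of items, and merging
corresponds to union, so a node of the tree is the sketch of a dyadic block of machines. The visited
nodes cover exactly the machines other than `j` (`exists_node_iff`), with a bounded number of nodes
on each of at most `log₂ k + 1` levels. Hence `B_j` and `B_j'` are sketches of fixed streams, whose
numbers of distinct elements differ by exactly `f₁^(j)` (`card_otherSamples_append`). Both numbers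
are at most `d ≤ f₁ / c`, so two relative errors `ε` become an error `2 * ε / c * f₁` of the
difference. A union bound over the `2 * k` streams and a sum over the machines finish the proof. -/

section UniformProbability

/-! ### Probability on finite uniform spaces. -/

variable {Ω : Type*} [Fintype Ω]

theorem uniformProb_eq (P : Ω → Prop) [DecidablePred P] :
    uniformProb P = (#(univ.filter P) : ℝ) / (Fintype.card Ω : ℝ) := by
  unfold uniformProb
  congr!

theorem uniformProb_eq_uniformMean (P : Ω → Prop) [DecidablePred P] :
    uniformProb P = uniformMean (fun ω => if P ω then (1 : ℝ) else 0) := by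
  rw [uniformProb_eq, uniformMean, Finset.sum_boole]

theorem uniformProb_nonneg (P : Ω → Prop) : 0 ≤ uniformProb P := by
  unfold uniformProb; positivity

theorem uniformProb_mono {P Q : Ω → Prop} (h : ∀ ω, P ω → Q ω) :
    uniformProb P ≤ uniformProb Q := by
  classical
  rw [uniformProb_eq, uniformProb_eq]
  gcongr
  exact h _

theorem uniformProb_not [Nonempty Ω] (P : Ω → Prop) :
    uniformProb (fun ω => ¬ P ω) = 1 - uniformProb P := by
  classical
  rw [uniformProb_eq, uniformProb_eq]
  have hc : (Fintype.card Ω : ℝ) ≠ 0 := by exact_mod_cast Fintype.card_ne_zero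
  rw [eq_sub_iff_add_eq, ← add_div, div_eq_one_iff_eq hc]
  have := Finset.card_filter_add_card_filter_not (s := (univ : Finset Ω)) P
  rw [add_comm, ← Finset.card_univ]
  exact_mod_cast this

theorem uniformProb_exists_le {ι : Type*} (s : Finset ι) (P : ι → Ω → Prop) :
    uniformProb (fun ω => ∃ i ∈ s, P i ω) ≤ ∑ i ∈ s, uniformProb (P i) := by
  classical
  simp only [uniformProb_eq]
  rw [← Finset.sum_div]
  gcongr
  have : (univ.filter (fun ω => ∃ i ∈ s, P i ω)) ⊆ s.biUnion (fun i => univ.filter (P i)) := by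
    intro ω; simp
  exact_mod_cast (Finset.card_le_card this).trans Finset.card_biUnion_le

theorem uniformProb_or_le (P Q : Ω → Prop) :
    uniformProb (fun ω => P ω ∨ Q ω) ≤ uniformProb P + uniformProb Q := by
  have := uniformProb_exists_le (univ : Finset Bool) (fun b ω => if b then P ω else Q ω)
  simpa [or_comm] using this

theorem uniformMean_sum {ι : Type*} (s : Finset ι) (X : ι → Ω → ℝ) :
    uniformMean (fun ω => ∑ i ∈ s, X i ω) = ∑ i ∈ s, uniformMean (X i) := by
  unfold uniformMean
  rw [Finset.sum_comm, Finset.sum_div]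

theorem uniformMean_add (X Y : Ω → ℝ) :
    uniformMean (fun ω => X ω + Y ω) = uniformMean X + uniformMean Y := by
  unfold uniformMean
  rw [Finset.sum_add_distrib, add_div]

theorem uniformMean_const_mul (c : ℝ) (X : Ω → ℝ) :
    uniformMean (fun ω => c * X ω) = c * uniformMean X := by
  unfold uniformMean
  rw [← Finset.mul_sum, mul_div_assoc]

theorem uniformMean_const [Nonempty Ω] (c : ℝ) : uniformMean (fun _ : Ω => c) = c := by
  unfold uniformMean
  have hc : (Fintype.card Ω : ℝ) ≠ 0 := by exact_mod_cast Fintype.card_ne_zero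
  simp [hc]

theorem uniformMean_mono {X Y : Ω → ℝ} (h : ∀ ω, X ω ≤ Y ω) :
    uniformMean X ≤ uniformMean Y := by
  unfold uniformMean
  gcongr
  exact h _

/-- Chebyshev's inequality. -/
theorem uniformProb_abs_sub_le [Nonempty Ω] (X : Ω → ℝ) {μ v t : ℝ} (ht : 0 < t)
    (hμ : uniformMean X = μ) (hv : uniformMean (fun ω => X ω * X ω) ≤ μ ^ 2 + v) :
    uniformProb (fun ω => t ≤ |X ω - μ|) ≤ v / t ^ 2 := by
  classical
  rw [le_div_iff₀ (by positivity), uniformProb_eq_uniformMean, mul_comm, ← uniformMean_const_mul]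
  have h1 : uniformMean (fun ω => X ω * X ω + ((-2 * μ) * X ω + μ ^ 2)) ≤ v := by
    rw [uniformMean_add, uniformMean_add, uniformMean_const_mul, hμ, uniformMean_const]
    linarith
  refine (uniformMean_mono fun ω => ?_).trans h1
  have h2 : X ω * X ω + ((-2 * μ) * X ω + μ ^ 2) = |X ω - μ| ^ 2 := by rw [sq_abs]; ring
  rw [h2]
  split_ifs with h
  · rw [mul_one]; gcongr
  · rw [mul_zero]; positivity

/-- Independence of the values of a uniformly random function. -/
theorem uniformProb_forall_mem {U C : Type*} [Fintype U] [DecidableEq U] [Fintype C]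
    [Nonempty C] (s : Finset U) (G : Finset C) :
    uniformProb (fun g : U → C => ∀ v ∈ s, g v ∈ G)
      = ((#G : ℝ) / (Fintype.card C : ℝ)) ^ #s := by
  classical
  have hc : (Fintype.card C : ℝ) ≠ 0 := by exact_mod_cast Fintype.card_ne_zero
  have h1 : (univ.filter (fun g : U → C => ∀ v ∈ s, g v ∈ G))
      = Fintype.piFinset (fun v => if v ∈ s then G else univ) := by
    ext g
    simp only [mem_filter, mem_univ, true_and, Fintype.mem_piFinset]
    refine forall_congr' fun v => ?_
    split_ifs with h <;> simp [h]
  have h2 : (∏ v : U, #(if v ∈ s then G else (univ : Finset C)))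
      = #G ^ #s * Fintype.card C ^ #sᶜ := by
    rw [← Finset.prod_mul_prod_compl s, ← Finset.prod_const, ← Finset.prod_const]
    congr 1
    · exact Finset.prod_congr rfl fun v hv => by rw [if_pos hv]
    · exact Finset.prod_congr rfl fun v hv => by
        rw [if_neg (Finset.mem_compl.mp hv), Finset.card_univ]
  rw [uniformProb_eq, h1, Fintype.card_piFinset, h2, div_pow,
    div_eq_div_iff (by simp) (by positivity), Fintype.card_fun, ← Finset.card_add_card_compl s,
    pow_add]
  push_cast
  ring

end UniformProbability

/-! ### Joint distribution of the registers. -/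

namespace HLL

variable {p : HLL} {V : Type*}

/-- Telescoping from `M` to `K`. It makes a power of a register linear in the indicators of `M ≤ r`,
so that moments reduce to probabilities of such events. -/
theorem pow_eq_sum_of_le (x : ℝ) {M K : ℕ} (h : M ≤ K) :
    x ^ M = x ^ K + ∑ r ∈ range K, (x ^ r - x ^ (r + 1)) * (if M ≤ r then 1 else 0) := by
  induction K, h using Nat.le_induction with
  | base =>
    rw [Finset.sum_eq_zero, add_zero]
    intro r hr
    rw [if_neg (by simpa using hr), mul_zero]
  | succ K hK ih => rw [Finset.sum_range_succ, if_pos hK, ih]; ring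

theorem foldl_insertItem_le_iff (g : V → p.Cell) (l : List V) (M : p.Registers) (j : Fin p.m)
    (r : ℕ) : l.foldl (insertItem g) M j ≤ r ↔
      M j ≤ r ∧ ∀ v ∈ l, (g v).1 = j → rank (g v).2 ≤ r := by
  induction l generalizing M with
  | nil => simp
  | cons v l ih =>
    rw [List.foldl_cons, ih, List.forall_mem_cons, ← and_assoc]
    refine and_congr_left fun _ => ?_
    unfold insertItem
    by_cases h : (g v).1 = j
    · subst h; simp
    · rw [Function.update_of_ne (Ne.symm h)]; simp [h]

theorem scan_le_iff (g : V → p.Cell) (l : List V) (j : Fin p.m) (r : ℕ) :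
    scan g l j ≤ r ↔ ∀ v ∈ l, (g v).1 = j → rank (g v).2 ≤ r := by
  simp [scan, foldl_insertItem_le_iff]

theorem rank_le {L : ℕ} (w : Fin L → Bool) : rank w ≤ L + 1 := by
  unfold rank
  have := List.idxOf_le_length (a := true) (l := List.ofFn w)
  simp at this
  omega

theorem scan_le (g : V → p.Cell) (l : List V) (j : Fin p.m) : scan g l j ≤ p.L + 1 :=
  (scan_le_iff g l j _).2 fun _ _ _ => rank_le _

/-- The bound on `r` is sharp: the zero word has rank `L + 1`, so the equivalence fails for it at `r
= L + 1`. -/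
theorem lt_rank_iff {L : ℕ} (w : Fin L → Bool) {r : ℕ} (hr : r ≤ L) :
    r < rank w ↔ ∀ i : Fin L, (i : ℕ) < r → w i = false := by
  unfold rank
  rw [Nat.lt_succ_iff]
  constructor
  · intro h i hi
    have h1 := List.not_of_lt_findIdx (p := (· == true)) (xs := List.ofFn w) (i := i)
      (lt_of_lt_of_le hi h)
    simpa using h1
  · intro h
    by_contra! hlt
    have hlen : (List.ofFn w).idxOf true < (List.ofFn w).length := by simp; omega
    have h1 := List.getElem_idxOf hlen
    rw [List.getElem_ofFn] at h1
    rw [h _ hlt] at h1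
    simp at h1

theorem card_lt_rank {L r : ℕ} (hr : r ≤ L) :
    #(univ.filter (fun w : Fin L → Bool => r < rank w)) = 2 ^ (L - r) := by
  have h1 : univ.filter (fun w : Fin L → Bool => r < rank w)
      = Fintype.piFinset (fun i : Fin L => if (i : ℕ) < r then {false} else univ) := by
    ext w
    simp only [mem_filter, mem_univ, true_and, Fintype.mem_piFinset, lt_rank_iff w hr]
    refine forall_congr' fun i => ?_
    split_ifs with h <;> simp [h]
  rw [h1, Fintype.card_piFinset]
  have h2 : ∀ i : Fin L, #(if (i : ℕ) < r then ({false} : Finset Bool) else univ)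
      = if (i : ℕ) < r then 1 else 2 := by
    intro i; split_ifs <;> simp
  simp only [h2]
  rw [Fin.prod_univ_eq_prod_range (fun i => if i < r then 1 else 2) L,
    Finset.prod_ite, Finset.prod_const_one, one_mul, Finset.prod_const]
  congr 1
  have : (range L).filter (fun i => ¬ i < r) = Ico r L := by
    ext i; simp; omega
  rw [this, Nat.card_Ico]

/-- Probability that an item is hashed to a given register with a rank above `r`. -/
noncomputable def hitProb (p : HLL) (r : ℕ) : ℝ := (2 ^ r * (p.m : ℝ))⁻¹

/-- The hash values that push register `j` above `r`. -/
def hits (p : HLL) (j : Fin p.m) (r : ℕ) : Finset p.Cell :=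
  univ.filter (fun c => c.1 = j ∧ r < rank c.2)

theorem card_hits (j : Fin p.m) {r : ℕ} (hr : r ≤ p.L) : #(p.hits j r) = 2 ^ (p.L - r) := by
  have : p.hits j r = {j} ×ˢ univ.filter (fun w : Fin p.L → Bool => r < rank w) := by
    ext ⟨a, w⟩; simp [hits, and_comm, eq_comm]
  rw [this, card_product, card_lt_rank hr, card_singleton, one_mul]

theorem card_cell : Fintype.card p.Cell = p.m * 2 ^ p.L := by
  simp [Cell]

theorem card_hits_div (j : Fin p.m) {r : ℕ} (hr : r ≤ p.L) :
    (#(p.hits j r) : ℝ) / (Fintype.card p.Cell : ℝ) = p.hitProb r := by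
  have hm : (p.m : ℝ) ≠ 0 := by
    have := j.pos
    exact_mod_cast this.ne'
  rw [card_hits j hr, card_cell, hitProb]
  push_cast
  rw [div_eq_iff (by positivity)]
  have : (2 : ℝ) ^ p.L = 2 ^ r * 2 ^ (p.L - r) := by rw [← pow_add]; congr 1; omega
  rw [this]
  field_simp

theorem scan_le_iff_hits [DecidableEq V] (g : V → p.Cell) (l : List V) (j : Fin p.m) (r : ℕ) :
    scan g l j ≤ r ↔ ∀ v ∈ l.toFinset, g v ∈ (p.hits j r)ᶜ := by
  rw [scan_le_iff]
  simp [hits]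

theorem hitProb_nonneg (r : ℕ) : 0 ≤ p.hitProb r := by unfold hitProb; positivity

theorem hitProb_le (r : ℕ) : p.hitProb r ≤ (p.m : ℝ)⁻¹ := by
  unfold hitProb
  rcases Nat.eq_zero_or_pos p.m with h | h
  · simp [h]
  have : (0 : ℝ) < p.m := by exact_mod_cast h
  gcongr
  have : (1 : ℝ) ≤ 2 ^ r := one_le_pow₀ (by norm_num)
  nlinarith

/-- The indicator of the event that register `j` is at most `r`. -/
noncomputable def ind (l : List V) (r : ℕ) (j : Fin p.m) (g : V → p.Cell) : ℝ :=
  if scan g l j ≤ r then 1 else 0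

theorem ind_eq_one (l : List V) {r : ℕ} (hr : p.L < r) (j : Fin p.m) (g : V → p.Cell) :
    ind l r j g = 1 :=
  if_pos ((scan_le g l j).trans hr)

variable [Fintype V] [DecidableEq V]

theorem uniformProb_avoid [NeZero p.m] (A : Finset p.Cell) (s : Finset V) :
    uniformProb (fun g : V → p.Cell => ∀ v ∈ s, g v ∈ Aᶜ)
      = (1 - (#A : ℝ) / (Fintype.card p.Cell : ℝ)) ^ #s := by
  have hc : (Fintype.card p.Cell : ℝ) ≠ 0 := by exact_mod_cast Fintype.card_ne_zero
  rw [uniformProb_forall_mem, card_compl, Nat.cast_sub (Finset.card_le_univ _), sub_div,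
    div_self hc]

theorem uniformProb_scan_le [NeZero p.m] (l : List V) (j : Fin p.m) {r : ℕ} (hr : r ≤ p.L) :
    uniformProb (fun g : V → p.Cell => scan g l j ≤ r)
      = (1 - p.hitProb r) ^ #l.toFinset := by
  simp only [scan_le_iff_hits]
  rw [uniformProb_avoid, card_hits_div j hr]

/-- An item selects a single register, so the two sets of hits are disjoint and their probabilities
add. -/
theorem uniformProb_scan_le_and [NeZero p.m] (l : List V) {j j' : Fin p.m} (hj : j ≠ j')
    {r r' : ℕ} (hr : r ≤ p.L) (hr' : r' ≤ p.L) :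
    uniformProb (fun g : V → p.Cell => scan g l j ≤ r ∧ scan g l j' ≤ r')
      = (1 - (p.hitProb r + p.hitProb r')) ^ #l.toFinset := by
  have hd : Disjoint (p.hits j r) (p.hits j' r') := by
    rw [Finset.disjoint_left]
    intro c hc hc'
    simp only [hits, mem_filter, mem_univ, true_and] at hc hc'
    exact hj (hc.1.symm.trans hc'.1)
  have h : ∀ g : V → p.Cell, (scan g l j ≤ r ∧ scan g l j' ≤ r') ↔
      ∀ v ∈ l.toFinset, g v ∈ (p.hits j r ∪ p.hits j' r')ᶜ := by
    intro g
    rw [scan_le_iff_hits, scan_le_iff_hits, ← forall₂_and]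
    simp
  simp only [h]
  rw [uniformProb_avoid, card_union_of_disjoint hd]
  push_cast
  rw [add_div, card_hits_div j hr, card_hits_div j' hr']

theorem uniformMean_ind [NeZero p.m] (l : List V) {r : ℕ} (hr : r ≤ p.L) (j : Fin p.m) :
    uniformMean (ind (p := p) l r j) = (1 - p.hitProb r) ^ #l.toFinset := by
  unfold ind
  rw [← uniformProb_eq_uniformMean, uniformProb_scan_le l j hr]

theorem uniformMean_ind_mul_ind [NeZero p.m] (l : List V) {r r' : ℕ} (hr : r ≤ p.L)
    (hr' : r' ≤ p.L) {j j' : Fin p.m} (hj : j ≠ j') :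
    uniformMean (fun g : V → p.Cell => ind l r j g * ind l r' j' g)
      = (1 - (p.hitProb r + p.hitProb r')) ^ #l.toFinset := by
  rw [← uniformProb_scan_le_and l hj hr hr', uniformProb_eq_uniformMean]
  congr 1
  ext g
  unfold ind
  by_cases h : scan g l j ≤ r <;> simp [h]

/-- Different registers are negatively correlated. -/
theorem uniformMean_ind_mul_ind_le [NeZero p.m] (hm : 2 ≤ p.m) (l : List V) (r r' : ℕ)
    {j j' : Fin p.m} (hj : j ≠ j') :
    uniformMean (fun g : V → p.Cell => ind l r j g * ind l r' j' g)
      ≤ uniformMean (ind (p := p) l r j) * uniformMean (ind (p := p) l r' j') := by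
  -- Thresholds above `L` give certain events, to which the formula with `hitProb` does not apply.
  have hone : ∀ r : ℕ, p.L < r → ∀ j : Fin p.m, uniformMean (ind (p := p) l r j) = 1 := by
    intro r hr j
    simp only [funext fun g => ind_eq_one l hr j g]
    exact uniformMean_const 1
  rcases lt_or_ge p.L r with hr | hr
  · simp only [ind_eq_one l hr, one_mul, hone r hr]
    exact le_rfl
  rcases lt_or_ge p.L r' with hr' | hr'
  · simp only [ind_eq_one l hr', mul_one, hone r' hr']
    exact le_rfl
  rw [uniformMean_ind_mul_ind l hr hr' hj, uniformMean_ind l hr, uniformMean_ind l hr',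
    ← mul_pow]
  have h1 : (p.m : ℝ)⁻¹ ≤ 2⁻¹ := by
    gcongr; exact_mod_cast hm
  have h2 := p.hitProb_le r
  have h3 := p.hitProb_le r'
  gcongr
  · linarith
  -- The two sides differ by the product of the hit probabilities.
  · nlinarith [mul_nonneg (p.hitProb_nonneg r) (p.hitProb_nonneg r')]

end HLL

/-! ### Inequalities behind the variance bounds. -/

theorem uniformMean_sum_mul_sum_le {Ω : Type*} [Fintype Ω] {m : ℕ} (X : Fin m → Ω → ℝ)
    {e s : ℝ} (hs : ∀ j, uniformMean (fun ω => X j ω * X j ω) ≤ s)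
    (hc : ∀ j j', j ≠ j' → uniformMean (fun ω => X j ω * X j' ω) ≤ e * e) :
    uniformMean (fun ω => (∑ j, X j ω) * ∑ j, X j ω) ≤ (m * e) ^ 2 + m * s := by
  simp only [Finset.sum_mul_sum, uniformMean_sum]
  have h : ∀ j j', uniformMean (fun ω => X j ω * X j' ω) ≤ e * e + if j = j' then s else 0 := by
    intro j j'
    split_ifs with h
    · subst h; exact (hs j).trans (le_add_of_nonneg_left (mul_self_nonneg e))
    · rw [add_zero]; exact hc j j' h
  refine (Finset.sum_le_sum fun j _ => Finset.sum_le_sum fun j' _ => h j j').trans ?_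
  simp only [Finset.sum_add_distrib, Finset.sum_ite_eq, Finset.mem_univ, if_true,
    Finset.sum_const, Finset.card_univ, Fintype.card_fin, nsmul_eq_mul]
  exact le_of_eq (by ring)

/-- Only the scales with `2 ^ r` near `x` matter. With `y = x / 2 ^ r` a term equals `y ^ 2 * exp
(-y) / x ^ 2`; it is dominated by an increment of `t / (1 + t)` between `y` and `2 * y`, and these
increments telescope. -/
theorem sum_quarter_pow_mul_exp_le {x : ℝ} (hx : 0 < x) (K : ℕ) :
    ∑ r ∈ range K, (1 / 4 : ℝ) ^ r * Real.exp (-(x / 2 ^ r)) ≤ 12 / x ^ 2 := by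
  have hF : ∀ y : ℝ, 0 < y →
      y ^ 2 * Real.exp (-y) ≤ 12 * (2 * y / (1 + 2 * y) - y / (1 + y)) := by
    intro y hy
    have h1 : 2 * y / (1 + 2 * y) - y / (1 + y) = y / ((1 + 2 * y) * (1 + y)) := by
      field_simp; ring
    rw [h1, Real.exp_neg, ← div_eq_mul_inv, mul_div_assoc', div_le_div_iff₀ (Real.exp_pos y)
      (by positivity)]
    have h2 := Real.sum_le_exp_of_nonneg hy.le 4
    -- The cubic Taylor polynomial of `exp` suffices; `12` matches the leading coefficients, `2 = 12
    -- / 6`.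
    simp only [Finset.sum_range_succ, Finset.sum_range_zero, Nat.factorial] at h2
    norm_num at h2
    have h3 : y * ((1 + 2 * y) * (1 + y)) ≤ 12 * Real.exp y := by
      nlinarith [pow_pos hy 2, pow_pos hy 3]
    nlinarith [mul_le_mul_of_nonneg_left h3 hy.le]
  have ht : ∀ r ∈ range K, (1 / 4 : ℝ) ^ r * Real.exp (-(x / 2 ^ r)) ≤
      12 / x ^ 2 * ((fun r : ℕ => (2 * (x / 2 ^ r)) / (1 + 2 * (x / 2 ^ r))) r
        - (fun r : ℕ => (2 * (x / 2 ^ r)) / (1 + 2 * (x / 2 ^ r))) (r + 1)) := by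
    intro r _
    have h1 := hF (x / 2 ^ r) (by positivity)
    have h2 : 2 * (x / 2 ^ (r + 1)) = x / 2 ^ r := by rw [pow_succ]; field_simp
    simp only [h2]
    have h3 : (1 / 4 : ℝ) ^ r = (x / 2 ^ r) ^ 2 / x ^ 2 := by
      rw [div_pow, one_pow, div_pow, ← pow_mul, mul_comm r 2, pow_mul]
      norm_num
      field_simp
    rw [h3, div_mul_eq_mul_div, div_mul_eq_mul_div]
    gcongr
  refine (Finset.sum_le_sum ht).trans ?_
  rw [← Finset.mul_sum, Finset.sum_range_sub']
  have h4 : 2 * (x / 2 ^ 0) / (1 + 2 * (x / 2 ^ 0)) ≤ 1 := by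
    rw [div_le_one (by positivity)]; linarith
  have h5 : 0 ≤ 2 * (x / 2 ^ K) / (1 + 2 * (x / 2 ^ K)) := by positivity
  calc _ ≤ 12 / x ^ 2 * 1 := by gcongr; linarith
    _ = _ := mul_one _

theorem pow_sub_pow_le_mul {u v : ℝ} (hv : 0 ≤ v) (huv : v ≤ u) (D : ℕ) :
    u ^ D - v ^ D ≤ D * (u - v) * u ^ (D - 1) := by
  rw [← (Commute.all u v).mul_geom_sum₂, mul_comm (D : ℝ), mul_assoc]
  gcongr
  have hs : (D : ℝ) * u ^ (D - 1) = ∑ _i ∈ range D, u ^ (D - 1) := by simp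
  rw [hs]
  refine Finset.sum_le_sum fun i hi => ?_
  have hi' := Finset.mem_range.1 hi
  have hu := hv.trans huv
  calc u ^ i * v ^ (D - 1 - i) ≤ u ^ i * u ^ (D - 1 - i) := by gcongr
    _ = u ^ (D - 1) := by rw [← pow_add]; congr 1; omega

theorem mul_le_pow_sub_pow {u v : ℝ} (hv : 0 ≤ v) (huv : v ≤ u) (D : ℕ) :
    D * (u - v) * v ^ (D - 1) ≤ u ^ D - v ^ D := by
  rw [← (Commute.all u v).mul_geom_sum₂, mul_comm (D : ℝ), mul_assoc]
  gcongr
  have hs : (D : ℝ) * v ^ (D - 1) = ∑ _i ∈ range D, v ^ (D - 1) := by simp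
  rw [hs]
  refine Finset.sum_le_sum fun i hi => ?_
  have hi' := Finset.mem_range.1 hi
  calc v ^ (D - 1) = v ^ i * v ^ (D - 1 - i) := by rw [← pow_add]; congr 1; omega
    _ ≤ u ^ i * v ^ (D - 1 - i) := by gcongr

/-- The variance of the number of empty bins after throwing `D` balls into `m` bins. -/
theorem variance_empty_bins_le {m : ℝ} (hm : 2 ≤ m) (D : ℕ) :
    m * (1 - m⁻¹) ^ D + m * (m - 1) * (1 - (m⁻¹ + m⁻¹)) ^ D
      ≤ (m * (1 - m⁻¹) ^ D) ^ 2 + (D : ℝ) ^ 2 / m := by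
  set x := m⁻¹ with hx
  have hm0 : 0 < m := by linarith
  have hx0 : 0 < x := by positivity
  have hmx : m * x = 1 := by rw [hx]; field_simp
  have hx2 : x ≤ 1 / 2 := by rw [hx]; rw [inv_le_comm₀ hm0 (by norm_num)]; linarith
  have hv : 0 ≤ 1 - (x + x) := by linarith
  have h1 := pow_sub_pow_le_mul hv (by linarith : 1 - (x + x) ≤ 1 - x) D
  have h2 := mul_le_pow_sub_pow hv (by nlinarith : 1 - (x + x) ≤ (1 - x) ^ 2) D
  have h3 := pow_sub_pow_le_mul hv (by linarith : 1 - (x + x) ≤ 1 - x) (D - 1)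
  have e1 : (1 - x) - (1 - (x + x)) = x := by ring
  have e2 : (1 - x) ^ 2 - (1 - (x + x)) = x ^ 2 := by ring
  rw [e1] at h1 h3
  rw [e2] at h2
  set p := (1 - x) ^ D
  set p2 := (1 - (x + x)) ^ D
  set a := (1 - x) ^ (D - 1)
  set b := (1 - (x + x)) ^ (D - 1)
  have h4 : ((1 - x) ^ 2) ^ D = p ^ 2 := by rw [← pow_mul, mul_comm, pow_mul]
  rw [h4] at h2
  have h5 : (1 - x) ^ (D - 1 - 1) ≤ 1 := pow_le_one₀ (by linarith) (by linarith)
  have hD : ((D - 1 : ℕ) : ℝ) ≤ D := by exact_mod_cast Nat.sub_le D 1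
  have h6 : a - b ≤ D * x := by
    refine h3.trans ?_
    calc ((D - 1 : ℕ) : ℝ) * x * (1 - x) ^ (D - 1 - 1) ≤ D * x * 1 := by
          gcongr
          exact pow_nonneg (by linarith) _
      _ = _ := mul_one _
  -- The variance is `m * (p - p2) - m ^ 2 * (p ^ 2 - p2)`. Both parts are about `D`; their main
  -- terms cancel and leave `D * (a - b)`, which is at most `D ^ 2 / m`.
  have h7 : m * (p - p2) ≤ D * a := by
    calc m * (p - p2) ≤ m * (D * x * a) := by gcongr
      _ = (m * x) * (D * a) := by ring
      _ = _ := by rw [hmx, one_mul]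
  have h8 : D * b ≤ m ^ 2 * (p ^ 2 - p2) := by
    calc D * b = (m * x) ^ 2 * (D * b) := by rw [hmx]; ring
      _ = m ^ 2 * (D * x ^ 2 * b) := by ring
      _ ≤ _ := by gcongr
  have h9 : (D : ℝ) ^ 2 / m = D * (D * x) := by rw [hx]; field_simp
  rw [h9]
  nlinarith [mul_le_mul_of_nonneg_left h6 (Nat.cast_nonneg D : (0 : ℝ) ≤ D)]

/-! ### Moments of the harmonic sum and of the number of empty registers. -/

namespace HLL

variable {p : HLL} {V : Type*}

/-- The expectation of `2 ^ (-M)` for a register `M` after `D` distinct items. -/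
noncomputable def registerMean (p : HLL) (D : ℕ) : ℝ :=
  (1 / 2 : ℝ) ^ (p.L + 1) + ∑ r ∈ range (p.L + 1), (1 / 2 : ℝ) ^ (r + 1) * (1 - p.hitProb r) ^ D

/-- The constant of the telescoping sum is booked on the certain event `r = L + 1`. All weights are
then nonnegative, and a product of two such sums is one double sum of products of indicators. -/
theorem half_pow_scan (g : V → p.Cell) (l : List V) (j : Fin p.m) :
    (1 / 2 : ℝ) ^ (scan g l j) = ∑ r ∈ range (p.L + 2),
      (if r = p.L + 1 then (1 / 2 : ℝ) ^ (p.L + 1) else (1 / 2 : ℝ) ^ (r + 1)) * ind l r j g := by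
  rw [Finset.sum_range_succ, if_pos rfl, ind_eq_one l (Nat.lt_succ_self _), mul_one,
    pow_eq_sum_of_le (1 / 2) (scan_le g l j), add_comm]
  congr 1
  refine Finset.sum_congr rfl fun r hr => ?_
  rw [if_neg (Finset.mem_range.1 hr).ne, ind]
  congr 1
  ring

theorem harmonicSum_scan (g : V → p.Cell) (l : List V) :
    harmonicSum (scan g l) = ∑ j, (1 / 2 : ℝ) ^ (scan g l j) := by
  simp [harmonicSum]

theorem pow_one_sub_hitProb_le [NeZero p.m] (hm : 2 ≤ p.m) (r D : ℕ) :
    (1 - p.hitProb r) ^ D ≤ Real.exp (-((D / p.m : ℝ) / 2 ^ r)) := by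
  have h1 : (p.m : ℝ)⁻¹ ≤ 2⁻¹ := by
    gcongr; exact_mod_cast hm
  have h2 := p.hitProb_le r
  have hm0 : (0 : ℝ) < p.m := by positivity
  calc (1 - p.hitProb r) ^ D ≤ (Real.exp (-p.hitProb r)) ^ D := by
        gcongr
        · linarith
        · linarith [Real.add_one_le_exp (-p.hitProb r)]
    _ = _ := by
        rw [← Real.exp_nat_mul]
        congr 1
        unfold hitProb
        field_simp

/-- The number of empty registers. -/
def numEmpty (M : p.Registers) : ℕ := (univ.filter (fun j => M j = 0)).card

theorem numEmpty_scan (g : V → p.Cell) (l : List V) :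
    (numEmpty (scan g l) : ℝ) = ∑ j, ind l 0 j g := by
  unfold numEmpty ind
  rw [Finset.sum_boole]
  simp

section Moments

variable [Fintype V] [DecidableEq V]

theorem uniformMean_half_pow_scan [NeZero p.m] (l : List V) (j : Fin p.m) :
    uniformMean (fun g : V → p.Cell => (1 / 2 : ℝ) ^ (scan g l j))
      = p.registerMean #l.toFinset := by
  simp only [half_pow_scan]
  rw [uniformMean_sum, Finset.sum_range_succ, registerMean, add_comm]
  congr 1
  · rw [uniformMean_const_mul, if_pos rfl]
    have h : (ind l (p.L + 1) j : (V → p.Cell) → ℝ) = fun _ => 1 :=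
      funext fun g => ind_eq_one l (Nat.lt_succ_self _) j g
    rw [h, uniformMean_const, mul_one]
  · refine Finset.sum_congr rfl fun r hr => ?_
    have hr' := Finset.mem_range.1 hr
    rw [if_neg hr'.ne, uniformMean_const_mul]
    congr 1
    exact uniformMean_ind l (Nat.lt_succ_iff.1 hr') j

/-- Negative correlation passes from the indicators to their combinations with nonnegative weights.
-/
theorem uniformMean_half_pow_scan_mul_le [NeZero p.m] (hm : 2 ≤ p.m) (l : List V)
    {j j' : Fin p.m} (hj : j ≠ j') :
    uniformMean (fun g : V → p.Cell => (1 / 2 : ℝ) ^ (scan g l j) * (1 / 2 : ℝ) ^ (scan g l j'))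
      ≤ p.registerMean #l.toFinset * p.registerMean #l.toFinset := by
  nth_rw 1 [← uniformMean_half_pow_scan l j]
  rw [← uniformMean_half_pow_scan l j']
  simp only [half_pow_scan, Finset.sum_mul_sum, uniformMean_sum, uniformMean_const_mul]
  refine Finset.sum_le_sum fun r _ => Finset.sum_le_sum fun r' _ => ?_
  have h := uniformMean_ind_mul_ind_le hm l r r' hj
  set w : ℕ → ℝ := fun r =>
    if r = p.L + 1 then (1 / 2 : ℝ) ^ (p.L + 1) else (1 / 2 : ℝ) ^ (r + 1) with hw
  have hw0 : ∀ r, 0 ≤ w r := by intro r; simp only [hw]; split_ifs <;> positivity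
  calc uniformMean (fun g : V → p.Cell => (w r * ind l r j g) * (w r' * ind l r' j' g))
      = (w r * w r') * uniformMean (fun g : V → p.Cell => ind l r j g * ind l r' j' g) := by
        rw [← uniformMean_const_mul]; congr 1; ext g; ring
    _ ≤ (w r * w r') * (uniformMean (ind (p := p) l r j) * uniformMean (ind (p := p) l r' j')) := by
        exact mul_le_mul_of_nonneg_left h (mul_nonneg (hw0 _) (hw0 _))
    _ = _ := by ring

theorem uniformMean_harmonicSum [NeZero p.m] (l : List V) :
    uniformMean (fun g : V → p.Cell => harmonicSum (scan g l))
      = p.m * p.registerMean #l.toFinset := by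
  simp only [harmonicSum_scan, uniformMean_sum, uniformMean_half_pow_scan]
  simp

/-- A typical register value is `log₂ (D / m)`, so the square has order `(m / D) ^ 2`. Truncation at
`L + 1` is harmless because `D ≤ 2 ^ L`. The constant is `10 = 1 + 3 / 4 * 12`. -/
theorem uniformMean_quarter_pow_scan_le [NeZero p.m] (hm : 2 ≤ p.m) (l : List V)
    (hpos : 0 < #l.toFinset) (hD : #l.toFinset ≤ 2 ^ p.L) (j : Fin p.m) :
    uniformMean (fun g : V → p.Cell => (1 / 2 : ℝ) ^ (scan g l j) * (1 / 2 : ℝ) ^ (scan g l j))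
      ≤ 10 / (#l.toFinset / p.m : ℝ) ^ 2 := by
  set D := #l.toFinset
  have hm0 : (0 : ℝ) < p.m := by positivity
  have hm1 : (1 : ℝ) ≤ p.m := by exact_mod_cast (by omega : 1 ≤ p.m)
  have hD0 : (0 : ℝ) < D := by exact_mod_cast hpos
  have h1 : ∀ g : V → p.Cell, (1 / 2 : ℝ) ^ (scan g l j) * (1 / 2 : ℝ) ^ (scan g l j)
      = (1 / 4 : ℝ) ^ (p.L + 1)
        + ∑ r ∈ range (p.L + 1), (3 / 4 * (1 / 4 : ℝ) ^ r) * ind l r j g := by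
    intro g
    rw [← mul_pow]
    norm_num only
    rw [pow_eq_sum_of_le (1 / 4) (scan_le g l j)]
    congr 1
    refine Finset.sum_congr rfl fun r _ => ?_
    rw [ind]
    congr 1
    ring
  simp only [h1]
  rw [uniformMean_add, uniformMean_const, uniformMean_sum]
  have h2 : ∀ r ∈ range (p.L + 1),
      uniformMean (fun g : V → p.Cell => (3 / 4 * (1 / 4 : ℝ) ^ r) * ind l r j g)
        ≤ 3 / 4 * ((1 / 4 : ℝ) ^ r * Real.exp (-((D / p.m : ℝ) / 2 ^ r))) := by
    intro r hr
    rw [uniformMean_const_mul, mul_assoc]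
    gcongr
    refine (uniformMean_ind l (Nat.lt_succ_iff.1 (Finset.mem_range.1 hr)) j).le.trans ?_
    exact pow_one_sub_hitProb_le hm r D
  have h3 := sum_quarter_pow_mul_exp_le (x := (D / p.m : ℝ)) (by positivity) (p.L + 1)
  have h4 : (1 / 4 : ℝ) ^ (p.L + 1) ≤ 1 / (D / p.m : ℝ) ^ 2 := by
    have h5 : (D / p.m : ℝ) ≤ 2 ^ p.L := by
      calc (D / p.m : ℝ) ≤ D := div_le_self hD0.le hm1
        _ ≤ 2 ^ p.L := by exact_mod_cast hD
    rw [div_pow, one_pow]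
    gcongr
    calc (D / p.m : ℝ) ^ 2 ≤ (2 ^ p.L) ^ 2 := by gcongr
      _ = 4 ^ p.L := by rw [← pow_mul, mul_comm, pow_mul]; norm_num
      _ ≤ 4 ^ (p.L + 1) := by gcongr <;> norm_num
  calc _ ≤ 1 / (D / p.m : ℝ) ^ 2
        + ∑ r ∈ range (p.L + 1), 3 / 4 * ((1 / 4 : ℝ) ^ r * Real.exp (-((D / p.m : ℝ) / 2 ^ r))) :=
        add_le_add h4 (Finset.sum_le_sum h2)
    _ ≤ 1 / (D / p.m : ℝ) ^ 2 + 3 / 4 * (12 / (D / p.m : ℝ) ^ 2) := by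
        rw [← Finset.mul_sum]; gcongr
    _ = _ := by ring

theorem uniformMean_harmonicSum_mul_self_le [NeZero p.m] (hm : 2 ≤ p.m) (l : List V)
    (hpos : 0 < #l.toFinset) (hD : #l.toFinset ≤ 2 ^ p.L) :
    uniformMean (fun g : V → p.Cell => harmonicSum (scan g l) * harmonicSum (scan g l))
      ≤ (p.m * p.registerMean #l.toFinset) ^ 2
        + p.m * (10 / (#l.toFinset / p.m : ℝ) ^ 2) := by
  simp only [harmonicSum_scan]
  exact uniformMean_sum_mul_sum_le _ (uniformMean_quarter_pow_scan_le hm l hpos hD)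
    fun j j' hj => uniformMean_half_pow_scan_mul_le hm l hj

theorem uniformMean_numEmpty [NeZero p.m] (l : List V) :
    uniformMean (fun g : V → p.Cell => (numEmpty (scan g l) : ℝ))
      = p.m * (1 - (p.m : ℝ)⁻¹) ^ #l.toFinset := by
  simp only [numEmpty_scan, uniformMean_sum]
  have : ∀ j : Fin p.m, uniformMean (fun g : V → p.Cell => ind l 0 j g)
      = (1 - (p.m : ℝ)⁻¹) ^ #l.toFinset := by
    intro j
    refine (uniformMean_ind l (Nat.zero_le _) j).trans ?_
    simp [hitProb]
  simp [this]

theorem uniformMean_numEmpty_mul_self [NeZero p.m] (l : List V) :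
    uniformMean (fun g : V → p.Cell => (numEmpty (scan g l) : ℝ) * (numEmpty (scan g l) : ℝ))
      = p.m * (1 - (p.m : ℝ)⁻¹) ^ #l.toFinset
        + p.m * (p.m - 1) * (1 - ((p.m : ℝ)⁻¹ + (p.m : ℝ)⁻¹)) ^ #l.toFinset := by
  simp only [numEmpty_scan, Finset.sum_mul_sum, uniformMean_sum]
  have : ∀ j j' : Fin p.m, uniformMean (fun g : V → p.Cell => ind l 0 j g * ind l 0 j' g)
      = (1 - ((p.m : ℝ)⁻¹ + (p.m : ℝ)⁻¹)) ^ #l.toFinset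
        + if j = j' then ((1 - (p.m : ℝ)⁻¹) ^ #l.toFinset
          - (1 - ((p.m : ℝ)⁻¹ + (p.m : ℝ)⁻¹)) ^ #l.toFinset) else 0 := by
    intro j j'
    split_ifs with h
    · subst h
      have h1 : ∀ g : V → p.Cell, ind l 0 j g * ind l 0 j g = ind l 0 j g := by
        intro g; unfold ind; split_ifs <;> simp
      simp only [h1]
      refine (uniformMean_ind l (Nat.zero_le _) j).trans ?_
      simp [hitProb]
    · rw [uniformMean_ind_mul_ind l (Nat.zero_le _) (Nat.zero_le _) h]
      simp [hitProb]
  simp only [this, Finset.sum_add_distrib, Finset.sum_ite_eq, Finset.mem_univ, if_true,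
    Finset.sum_const, Finset.card_univ, Fintype.card_fin, nsmul_eq_mul]
  ring

end Moments

theorem expectedHarmonicSum_eq [NeZero p.m] (N : ℕ) :
    p.expectedHarmonicSum N = p.m * p.registerMean N := by
  rw [expectedHarmonicSum, uniformMean_harmonicSum]
  simp

end HLL

/-! ### Stable inversion of the two expectations. -/

theorem exp_neg_two_mul_le_pow {q : ℝ} (hq0 : 0 ≤ q) (hq : q ≤ 1 / 2) (D : ℕ) :
    Real.exp (-(2 * (q * D))) ≤ (1 - q) ^ D := by
  have h1 : (0 : ℝ) < 1 - q := by linarith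
  have h2 : Real.exp (-(2 * q)) ≤ 1 - q := by
    rw [← Real.le_log_iff_exp_le h1]
    refine le_trans ?_ (Real.one_sub_inv_le_log_of_pos h1)
    have : (1 - q)⁻¹ ≤ 1 + 2 * q := by
      rw [inv_le_iff_one_le_mul₀ h1]; nlinarith
    linarith
  calc Real.exp (-(2 * (q * D))) = Real.exp (-(2 * q)) ^ D := by
        rw [← Real.exp_nat_mul]; congr 1; ring
    _ ≤ _ := by gcongr

theorem exp_neg_le_one_sub_half {x : ℝ} (h0 : 0 ≤ x) (h1 : x ≤ 1) :
    Real.exp (-x) ≤ 1 - x / 2 := by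
  rw [Real.exp_neg, inv_le_iff_one_le_mul₀ (Real.exp_pos x)]
  nlinarith [Real.add_one_le_exp x]

theorem seven_le_exp_two : 7 ≤ Real.exp 2 := by
  have h := Real.exp_one_gt_d9
  have : Real.exp 2 = Real.exp 1 * Real.exp 1 := by rw [← Real.exp_add]; norm_num
  rw [this]; nlinarith

theorem exp_two_le_eight : Real.exp 2 ≤ 8 := by
  have h := Real.exp_one_lt_d9
  have h0 := Real.exp_pos 1
  have : Real.exp 2 = Real.exp 1 * Real.exp 1 := by rw [← Real.exp_add]; norm_num
  rw [this]; nlinarith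

theorem abs_log_sub_log_le {x y b : ℝ} (hb : 0 < b) (hx : b ≤ x) (hy : b ≤ y) :
    |Real.log x - Real.log y| ≤ |x - y| / b := by
  have key : ∀ u w : ℝ, b ≤ u → b ≤ w → Real.log u - Real.log w ≤ |u - w| / b := by
    intro u w hu hw
    have hw0 := hb.trans_le hw
    have hu0 := hb.trans_le hu
    rw [← Real.log_div hu0.ne' hw0.ne']
    calc Real.log (u / w) ≤ u / w - 1 := Real.log_le_sub_one_of_pos (div_pos hu0 hw0)
      _ = (u - w) / w := by field_simp
      _ ≤ |u - w| / w := by gcongr; exact le_abs_self _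
      _ ≤ _ := by gcongr
  rw [abs_le]
  constructor
  · have := key y x hy hx
    rw [abs_sub_comm] at this
    linarith
  · exact key x y hx hy

/-- Linear counting inverts the expected number of empty bins up to a small relative error. -/
theorem linear_counting_error {m ε V : ℝ} {D : ℕ} (hε : 0 < ε) (hm : 4 ≤ m)
    (hm' : 2 / ε ≤ m - 1) (hD : (D : ℝ) ≤ 2 * m) (hV : m / 4 ≤ V)
    (h : |V - m * (1 - m⁻¹) ^ D| ≤ ε * D / 128) :
    |m * Real.log (m / V) - D| ≤ ε * D := by
  have hm0 : 0 < m := by linarith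
  have hV0 : 0 < V := by linarith
  have hx2 : m⁻¹ ≤ 1 / 2 := by rw [inv_le_comm₀ hm0 (by norm_num)]; linarith
  have hx1 : (0 : ℝ) < 1 - m⁻¹ := by linarith
  set W := m * (1 - m⁻¹) ^ D with hW
  -- Since `D ≤ 2 * m`, the expected fraction of empty bins is at least `exp (-4)`, and `exp 2 ≤ 8`.
  -- On `[m / 64, ∞)` the logarithm is Lipschitz with constant `64 / m`, so the fluctuation of `V`
  -- costs half of the allowed error.
  have hW64 : m / 64 ≤ W := by
    have h1 := exp_neg_two_mul_le_pow (by positivity : 0 ≤ m⁻¹) hx2 D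
    have h2 : Real.exp (-4) ≤ Real.exp (-(2 * (m⁻¹ * D))) := by
      rw [Real.exp_le_exp, neg_le_neg_iff]
      have : m⁻¹ * D ≤ 2 := by
        rw [inv_mul_le_iff₀ hm0]; linarith
      linarith
    have h3 : (1 : ℝ) / 64 ≤ Real.exp (-4) := by
      rw [Real.exp_neg, one_div, inv_le_inv₀ (by norm_num) (Real.exp_pos _)]
      have : Real.exp 4 = Real.exp 2 * Real.exp 2 := by rw [← Real.exp_add]; norm_num
      rw [this]
      nlinarith [exp_two_le_eight, Real.exp_pos 2]
    rw [hW, div_eq_mul_one_div]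
    gcongr
    linarith
  have hW0 : 0 < W := by linarith [div_pos hm0 (by norm_num : (0 : ℝ) < 64)]
  have h1 := abs_log_sub_log_le (by positivity : 0 < m / 64) (by linarith : m / 64 ≤ V) hW64
  have h2 : m * |Real.log V - Real.log W| ≤ ε * D / 2 := by
    calc m * |Real.log V - Real.log W| ≤ m * (|V - W| / (m / 64)) := by gcongr
      _ = 64 * |V - W| := by field_simp
      _ ≤ 64 * (ε * D / 128) := by gcongr
      _ = _ := by ring
  have hlogW : Real.log W = Real.log m + D * Real.log (1 - m⁻¹) := by
    rw [hW, Real.log_mul hm0.ne' (pow_pos hx1 _).ne', Real.log_pow]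
  have h3 : Real.log (1 - m⁻¹) ≤ -m⁻¹ := by
    have := Real.log_le_sub_one_of_pos hx1
    linarith
  have h4 : -(1 / (m - 1)) ≤ Real.log (1 - m⁻¹) := by
    refine le_trans (le_of_eq ?_) (Real.one_sub_inv_le_log_of_pos hx1)
    have : m - 1 ≠ 0 := by linarith
    field_simp
    ring
  -- The other half pays for the bias of linear counting, which replaces `-log (1 - 1 / m)` by `1 /
  -- m`.
  have h5 : m * -Real.log (1 - m⁻¹) ≤ 1 + ε / 2 := by
    have h6 : 1 / (m - 1) ≤ ε / 2 := by
      rw [div_le_div_iff₀ (by linarith) (by norm_num)]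
      rw [div_le_iff₀ hε] at hm'
      linarith
    calc m * -Real.log (1 - m⁻¹) ≤ m * (1 / (m - 1)) := by gcongr; linarith
      _ = 1 + 1 / (m - 1) := by
        have : m - 1 ≠ 0 := by linarith
        field_simp
        ring
      _ ≤ _ := by linarith
  have h7 : 1 ≤ m * -Real.log (1 - m⁻¹) := by
    calc 1 = m * m⁻¹ := by field_simp
      _ ≤ _ := by gcongr; linarith
  have hDn : (0 : ℝ) ≤ D := Nat.cast_nonneg D
  have h8 : m * Real.log (m / V) - D
      = -(m * (Real.log V - Real.log W)) + D * (m * -Real.log (1 - m⁻¹) - 1) := by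
    rw [Real.log_div hm0.ne' hV0.ne', hlogW]; ring
  have h9 : |m * (Real.log V - Real.log W)| ≤ ε * D / 2 := by
    rwa [abs_mul, abs_of_pos hm0]
  have h10 : D * (m * -Real.log (1 - m⁻¹) - 1) ≤ D * (ε / 2) := by gcongr; linarith
  have h11 : 0 ≤ D * (m * -Real.log (1 - m⁻¹) - 1) := mul_nonneg hDn (by linarith)
  rw [h8, abs_le]
  rw [abs_le] at h9
  constructor <;> nlinarith [h9.1, h9.2]

/-- Used with `x = D / m` to find the rank at which a register expects between `1 / 2` and `1` hits.
The lower bound on `x` covers `r = 0`. -/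
theorem exists_two_pow_between {x : ℝ} (hx : 3 / 4 ≤ x) {L : ℕ} (hL : x ≤ 2 ^ L) :
    ∃ r ≤ L, x ≤ 2 ^ r ∧ (2 : ℝ) ^ r ≤ 2 * x := by
  classical
  have hex : ∃ r : ℕ, x ≤ 2 ^ r := ⟨L, hL⟩
  refine ⟨Nat.find hex, Nat.find_min' hex hL, Nat.find_spec hex, ?_⟩
  rcases Nat.eq_zero_or_pos (Nat.find hex) with h | h
  · rw [h]; linarith
  · have h1 := Nat.find_min hex (Nat.sub_lt h one_pos)
    rw [not_le] at h1
    calc (2 : ℝ) ^ Nat.find hex = 2 * 2 ^ (Nat.find hex - 1) := by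
          rw [← pow_succ']; congr 1; omega
      _ ≤ 2 * x := by gcongr

namespace HLL

variable {p : HLL} {V : Type*}

theorem hitProb_le_half (hm : 2 ≤ p.m) (r : ℕ) : p.hitProb r ≤ 1 / 2 := by
  refine (p.hitProb_le r).trans ?_
  rw [one_div]
  gcongr; exact_mod_cast hm

/-- The expectation of the harmonic sum is sensitive to relative changes of the cardinality. -/
theorem le_registerMean_sub (hm : 2 ≤ p.m) {ε : ℝ} (hε : 0 < ε) (hε1 : ε < 1) {D N N' : ℕ}
    (hD : 3 / 4 * (p.m : ℝ) ≤ D) (hDL : D ≤ 2 ^ p.L) (hND : N ≤ D)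
    (hNN : (N : ℝ) + ε * D / 2 ≤ N') :
    ε * p.m / (256 * D) ≤ p.registerMean N - p.registerMean N' := by
  have hm2 : (2 : ℝ) ≤ p.m := by exact_mod_cast hm
  have hm0 : (0 : ℝ) < p.m := by linarith
  have hD0 : (0 : ℝ) < D := by linarith
  have hle : N ≤ N' := by
    have : (N : ℝ) ≤ N' := by nlinarith [mul_pos hε hD0]
    exact_mod_cast this
  obtain ⟨r, hrL, hr1, hr2⟩ := exists_two_pow_between (x := (D : ℝ) / p.m) (L := p.L)
    (by rw [le_div_iff₀ hm0]; exact hD)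
    (by
      rw [div_le_iff₀ hm0]
      have : (D : ℝ) ≤ 2 ^ p.L := by exact_mod_cast hDL
      nlinarith [pow_pos (two_pos : (0 : ℝ) < 2) p.L])
  set q := p.hitProb r with hq
  have hq0 : 0 ≤ q := p.hitProb_nonneg r
  have hq2 : q ≤ 1 / 2 := hitProb_le_half hm r
  have hqD : q * D = (D / p.m : ℝ) / 2 ^ r := by
    rw [hq, hitProb]; field_simp
  have hqD1 : q * D ≤ 1 := by
    rw [hqD, div_le_one (by positivity)]; exact hr1
  have hqD2 : 1 / 2 ≤ q * D := by
    rw [hqD, le_div_iff₀ (by positivity)]; linarith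
  have h1 : p.registerMean N - p.registerMean N' = ∑ r ∈ range (p.L + 1),
      (1 / 2 : ℝ) ^ (r + 1) * ((1 - p.hitProb r) ^ N - (1 - p.hitProb r) ^ N') := by
    simp only [registerMean, mul_sub, Finset.sum_sub_distrib]; ring
  -- All summands are nonnegative because `N ≤ N'`, so the chosen scale alone bounds the difference
  -- from below.
  have h2 : (1 / 2 : ℝ) ^ (r + 1) * ((1 - q) ^ N - (1 - q) ^ N')
      ≤ p.registerMean N - p.registerMean N' := by
    rw [h1]
    refine Finset.single_le_sum (f := fun r => (1 / 2 : ℝ) ^ (r + 1) *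
      ((1 - p.hitProb r) ^ N - (1 - p.hitProb r) ^ N')) (fun i _ => ?_)
      (Finset.mem_range.2 (Nat.lt_succ_of_le hrL))
    refine mul_nonneg (by positivity) (sub_nonneg.2 ?_)
    exact pow_le_pow_of_le_one (by linarith [hitProb_le_half hm i])
      (by linarith [p.hitProb_nonneg i]) hle
  refine le_trans ?_ h2
  have h3 : 1 / 8 ≤ (1 - q) ^ N := by
    calc (1 : ℝ) / 8 ≤ Real.exp (-2) := by
          rw [Real.exp_neg, one_div, inv_le_inv₀ (by norm_num) (Real.exp_pos _)]
          exact exp_two_le_eight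
      _ ≤ Real.exp (-(2 * (q * D))) := by rw [Real.exp_le_exp]; linarith
      _ ≤ (1 - q) ^ D := exp_neg_two_mul_le_pow hq0 hq2 D
      _ ≤ (1 - q) ^ N := pow_le_pow_of_le_one (by linarith) (by linarith) hND
  have h4 : (1 - q) ^ (N' - N) ≤ 1 - ε / 8 := by
    calc (1 - q) ^ (N' - N) ≤ Real.exp (-q) ^ (N' - N) := by
          gcongr
          · linarith
          · linarith [Real.add_one_le_exp (-q)]
      _ = Real.exp (-(q * (N' - N))) := by
          rw [← Real.exp_nat_mul, Nat.cast_sub hle]; congr 1; ring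
      _ ≤ Real.exp (-(ε / 4)) := by
          rw [Real.exp_le_exp, neg_le_neg_iff]
          calc ε / 4 ≤ ε / 2 * (q * D) := by nlinarith
            _ = q * (ε * D / 2) := by ring
            _ ≤ q * (N' - N) := by gcongr; linarith
      _ ≤ 1 - ε / 4 / 2 := exp_neg_le_one_sub_half (by linarith) (by linarith)
      _ = _ := by ring
  have h5 : (1 - q) ^ N' = (1 - q) ^ N * (1 - q) ^ (N' - N) := by
    rw [← pow_add]; congr 1; omega
  have h6 : 1 / 8 * (ε / 8) ≤ (1 - q) ^ N - (1 - q) ^ N' := by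
    rw [h5, ← mul_one_sub]
    gcongr
    linarith
  have h7 : (p.m : ℝ) / (4 * D) ≤ (1 / 2 : ℝ) ^ (r + 1) := by
    rw [div_pow, one_pow, div_le_div_iff₀ (by positivity) (by positivity), pow_succ]
    have : (2 : ℝ) ^ r * p.m ≤ 2 * D := by
      calc (2 : ℝ) ^ r * p.m ≤ 2 * (D / p.m) * p.m := by gcongr
        _ = 2 * D := by field_simp
    linarith
  -- The factors are the weight of the scale, the chance of no hit among `N` items, and the relative
  -- drop due to the items from `N` to `N'`.
  calc ε * p.m / (256 * D) = p.m / (4 * D) * (1 / 8 * (ε / 8)) := by field_simp; norm_num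
    _ ≤ _ := by gcongr

/-- The bias-free harmonic mean estimate is accurate if the harmonic sum is close to its
expectation. -/
theorem abs_findGreatest_sub_le [NeZero p.m] (hm : 2 ≤ p.m) {ε : ℝ} (hε : 0 < ε) (hε1 : ε < 1)
    {D : ℕ} (hD : 3 / 4 * (p.m : ℝ) ≤ D) (hDL : D ≤ 2 ^ p.L) (hDn : D ≤ p.n)
    (hDε : 2 ≤ ε * D) {z : ℝ} [DecidablePred fun N => z ≤ p.expectedHarmonicSum N]
    (hz : |z - p.m * p.registerMean D| < p.m * (ε * p.m / (256 * D))) :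
    |((Nat.findGreatest (fun N => z ≤ p.expectedHarmonicSum N) p.n : ℕ) : ℝ) - D| ≤ ε * D := by
  have hm0 : (0 : ℝ) < p.m := by positivity
  have hD0 : (0 : ℝ) < D := by
    have : (0 : ℝ) ≤ D := Nat.cast_nonneg D
    nlinarith
  rw [abs_lt] at hz
  set F := Nat.findGreatest (fun N => z ≤ p.expectedHarmonicSum N) p.n with hF
  rw [abs_le]
  constructor
  -- Rounding up costs less than `1 ≤ ε * D / 2`, so `N` is still `ε * D / 2` below `D` and passes
  -- the test.
  · set N := ⌈(1 - ε) * D⌉₊ with hN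
    have hN1 : (1 - ε) * D ≤ N := Nat.le_ceil _
    have hN2 : (N : ℝ) < (1 - ε) * D + 1 :=
      Nat.ceil_lt_add_one (mul_nonneg (by linarith) hD0.le)
    have hN3 : N ≤ D := by
      rw [hN, Nat.ceil_le]; nlinarith
    have h1 := le_registerMean_sub hm hε hε1 hD hDL hN3 (N' := D) (by linarith)
    have h2 := mul_le_mul_of_nonneg_left h1 hm0.le
    have h3 : z ≤ p.expectedHarmonicSum N := by
      rw [expectedHarmonicSum_eq]; linarith [hz.2]
    have h4 : N ≤ F := Nat.le_findGreatest (hN3.trans hDn) h3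
    have h5 : (N : ℝ) ≤ F := by exact_mod_cast h4
    linarith
  · by_contra! hlt
    -- `Nat.findGreatest` returns `0` by default, so only a nonzero value is known to pass the test.
    have hF0 : F ≠ 0 := by
      intro h0
      rw [h0] at hlt
      push_cast at hlt
      nlinarith
    have h1 : z ≤ p.expectedHarmonicSum F := Nat.findGreatest_of_ne_zero hF.symm hF0
    have h2 := le_registerMean_sub hm hε hε1 hD hDL le_rfl (N' := F) (by nlinarith)
    have h3 := mul_le_mul_of_nonneg_left h2 hm0.le
    rw [expectedHarmonicSum_eq] at h1
    linarith [hz.1]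

/-- Every nonempty register was selected by some item. Thus fewer than `m / 4` empty registers force
`D` above `3 * m / 4`, the range where the harmonic mean is reliable. -/
theorem sub_numEmpty_le [DecidableEq V] (g : V → p.Cell) (l : List V) :
    p.m ≤ numEmpty (scan g l) + #l.toFinset := by
  have h1 : univ.filter (fun j => ¬ scan g l j = 0) ⊆ l.toFinset.image (fun v => (g v).1) := by
    intro j hj
    simp only [mem_filter, mem_univ, true_and] at hj
    simp only [mem_image, List.mem_toFinset]
    by_contra! hne
    exact hj (Nat.le_zero.1 ((scan_le_iff g l j 0).2 fun v hv hvj => absurd hvj (hne v hv)))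
  have h2 := (card_le_card h1).trans card_image_le
  have h3 := card_filter_add_card_filter_not (s := (univ : Finset (Fin p.m)))
    (fun j => scan g l j = 0)
  rw [Finset.card_univ, Fintype.card_fin] at h3
  unfold numEmpty
  omega

variable [Fintype V] [DecidableEq V]

theorem uniformProb_numEmpty_le [NeZero p.m] (hm : 2 ≤ p.m) (l : List V) {t : ℝ} (ht : 0 < t) :
    uniformProb (fun g : V → p.Cell =>
      t ≤ |(numEmpty (scan g l) : ℝ) - p.m * (1 - (p.m : ℝ)⁻¹) ^ #l.toFinset|)
      ≤ ((#l.toFinset : ℝ) ^ 2 / p.m) / t ^ 2 :=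
  uniformProb_abs_sub_le _ ht (uniformMean_numEmpty l)
    ((uniformMean_numEmpty_mul_self l).le.trans
      (variance_empty_bins_le (by exact_mod_cast hm) _))

/-- For `D` much larger than `m` the variance bound `D ^ 2 / m` is useless; negative correlation
gives the bound `m`. -/
theorem uniformProb_numEmpty_le_of_large [NeZero p.m] (hm : 2 ≤ p.m) (l : List V) {t : ℝ}
    (ht : 0 < t) :
    uniformProb (fun g : V → p.Cell =>
      t ≤ |(numEmpty (scan g l) : ℝ) - p.m * (1 - (p.m : ℝ)⁻¹) ^ #l.toFinset|)
      ≤ p.m / t ^ 2 := by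
  refine uniformProb_abs_sub_le _ ht (uniformMean_numEmpty l)
    ((uniformMean_numEmpty_mul_self l).le.trans ?_)
  have hm2 : (2 : ℝ) ≤ p.m := by exact_mod_cast hm
  have h1 : (p.m : ℝ)⁻¹ ≤ 2⁻¹ := by gcongr
  have h0 : (0 : ℝ) ≤ (p.m : ℝ)⁻¹ := by positivity
  set x := (p.m : ℝ)⁻¹
  have h2 : (1 - x) ^ #l.toFinset ≤ 1 := pow_le_one₀ (by linarith) (by linarith)
  have h3 : (1 - (x + x)) ^ #l.toFinset ≤ ((1 - x) ^ #l.toFinset) ^ 2 := by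
    rw [← pow_mul, mul_comm, pow_mul]
    gcongr
    · linarith
    · nlinarith
  have h4 : 0 ≤ (1 - (x + x)) ^ #l.toFinset := pow_nonneg (by linarith) _
  have h5 : (p.m : ℝ) * (p.m - 1) * (1 - (x + x)) ^ #l.toFinset
      ≤ p.m * p.m * ((1 - x) ^ #l.toFinset) ^ 2 := by
    gcongr
    linarith
  nlinarith

theorem uniformProb_harmonicSum_le [NeZero p.m] (hm : 2 ≤ p.m) (l : List V)
    (hpos : 0 < #l.toFinset) (hD : #l.toFinset ≤ 2 ^ p.L) {t : ℝ} (ht : 0 < t) :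
    uniformProb (fun g : V → p.Cell =>
      t ≤ |harmonicSum (scan g l) - p.m * p.registerMean #l.toFinset|)
      ≤ (p.m * (10 / (#l.toFinset / p.m : ℝ) ^ 2)) / t ^ 2 :=
  uniformProb_abs_sub_le _ ht (uniformMean_harmonicSum l)
    (uniformMean_harmonicSum_mul_self_le hm l hpos hD)

end HLL

/-! ### Relative error of a single copy. -/

namespace HLL

variable {p : HLL} {V : Type*} [Fintype V] [DecidableEq V]

theorem estimateCopy_of_empty (hm : 0 < p.m) {M : p.Registers} (hM : ∀ j, M j = 0) :
    p.estimateCopy M = 0 := by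
  have hm0 : (p.m : ℝ) ≠ 0 := by exact_mod_cast hm.ne'
  have hV : (univ.filter (fun j => M j = 0)).card = p.m := by simp [hM]
  unfold estimateCopy
  simp only [hV]
  rw [if_pos (by omega), div_self hm0, Real.log_one, mul_zero]

theorem estimateCopy_of_le {M : p.Registers} (h : p.m ≤ 4 * numEmpty M) :
    p.estimateCopy M = p.m * Real.log (p.m / numEmpty M) := by
  unfold estimateCopy
  exact if_pos h

open Classical in
theorem estimateCopy_of_lt {M : p.Registers} (h : 4 * numEmpty M < p.m) :
    p.estimateCopy M =
      ((Nat.findGreatest (fun N => harmonicSum M ≤ p.expectedHarmonicSum N) p.n : ℕ) : ℝ) := by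
  unfold estimateCopy
  exact if_neg (not_le.2 h)

/-- The relative error of a single copy is at most `ε`, except with probability `1 / 16`. -/
theorem uniformProb_estimateCopy_le {ε : ℝ} (hε : 0 < ε) (hε1 : ε < 1)
    (hm : 10 ^ 8 / ε ^ 2 ≤ p.m) (hnL : p.n ≤ 2 ^ p.L) (l : List V) (hD : #l.toFinset ≤ p.n) :
    uniformProb (fun g : V → p.Cell =>
      ¬ |p.estimateCopy (scan g l) - (#l.toFinset : ℝ)| ≤ ε * #l.toFinset) ≤ 1 / 16 := by
  classical
  set D := #l.toFinset with hDdef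
  have hε2 : ε ^ 2 < 1 := by nlinarith
  rw [div_le_iff₀ (by positivity)] at hm
  have hm8 : (10 : ℝ) ^ 8 ≤ p.m := by
    have : (0 : ℝ) ≤ p.m := Nat.cast_nonneg _
    nlinarith
  have hm0 : (0 : ℝ) < p.m := by linarith
  have hm2 : 2 ≤ p.m := by
    have : (2 : ℝ) ≤ p.m := by linarith
    exact_mod_cast this
  have : NeZero p.m := ⟨by omega⟩
  have hmε : 10 ^ 8 / ε ≤ p.m := by
    rw [div_le_iff₀ hε]
    nlinarith
  -- For no items a relative error bound demands the exact value `0`, which linear counting gives as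
  -- `m * log 1`.
  rcases Nat.eq_zero_or_pos D with h0 | hpos
  · have hl : l = [] := by
      rw [hDdef, Finset.card_eq_zero, List.toFinset_eq_empty_iff] at h0
      exact h0
    have : ∀ g : V → p.Cell, p.estimateCopy (scan g l) = 0 := fun g =>
      estimateCopy_of_empty (by omega) fun j => by simp [hl, scan]
    simp only [this, h0]
    simp [uniformProb]
  have hD0 : (0 : ℝ) < D := by exact_mod_cast hpos
  have hDL := hD.trans hnL
  set W : ℝ := p.m * (1 - (p.m : ℝ)⁻¹) ^ D with hW
  -- For `D ≤ 2 * m` this is the precision that linear counting needs. For larger `D` it only has to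
  -- exclude that branch: the mean is at most `m / 7`, and `1 / 7 + 1 / 10 < 1 / 4`.
  set t : ℝ := if (D : ℝ) ≤ 2 * p.m then ε * D / 128 else p.m / 10 with ht
  set s : ℝ := p.m * (ε * p.m / (256 * D)) with hs
  have ht0 : 0 < t := by rw [ht]; split_ifs <;> positivity
  have hs0 : 0 < s := by positivity
  -- Outside two Chebyshev events the branch that the estimator takes is accurate, whichever it is;
  -- the branch need not be determined by `D`.
  have key : ∀ g : V → p.Cell,
      ¬ |p.estimateCopy (scan g l) - (D : ℝ)| ≤ ε * D →
      t ≤ |(numEmpty (scan g l) : ℝ) - W|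
        ∨ s ≤ |harmonicSum (scan g l) - p.m * p.registerMean D| := by
    intro g hbad
    by_contra! hcon
    refine hbad ?_
    obtain ⟨h1, h2⟩ := hcon
    rcases le_or_gt p.m (4 * numEmpty (scan g l)) with hV | hV
    · rw [estimateCopy_of_le hV]
      have hV' : (p.m : ℝ) / 4 ≤ numEmpty (scan g l) := by
        have : (p.m : ℝ) ≤ 4 * numEmpty (scan g l) := by exact_mod_cast hV
        linarith
      by_cases hDm : (D : ℝ) ≤ 2 * p.m
      · rw [ht, if_pos hDm] at h1
        refine linear_counting_error hε (by linarith) ?_ hDm hV' h1.le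
        have : 2 / ε + 1 ≤ 10 ^ 8 / ε := by
          rw [div_add' _ _ _ hε.ne']
          gcongr
          linarith
        linarith
      · exfalso
        rw [ht, if_neg hDm] at h1
        have h3 : (1 - (p.m : ℝ)⁻¹) ^ D ≤ 1 / 7 := by
          have hx : (p.m : ℝ)⁻¹ ≤ 1 := inv_le_one_of_one_le₀ (by linarith)
          calc (1 - (p.m : ℝ)⁻¹) ^ D ≤ Real.exp (-(p.m : ℝ)⁻¹) ^ D := by
                refine pow_le_pow_left₀ (by linarith) ?_ _
                linarith [Real.add_one_le_exp (-(p.m : ℝ)⁻¹)]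
            _ = Real.exp (-(D / p.m)) := by
                rw [← Real.exp_nat_mul]; congr 1; field_simp
            _ ≤ Real.exp (-2) := by
                rw [Real.exp_le_exp, neg_le_neg_iff, le_div_iff₀ hm0]
                exact (not_le.1 hDm).le
            _ ≤ 1 / 7 := by
                rw [Real.exp_neg, one_div, inv_le_inv₀ (Real.exp_pos _) (by norm_num)]
                exact seven_le_exp_two
        have h4 : W ≤ p.m * (1 / 7) := by rw [hW]; gcongr
        have h5 := (abs_lt.1 h1).2
        linarith
    · rw [estimateCopy_of_lt hV]
      have hD34 : 3 / 4 * (p.m : ℝ) ≤ D := by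
        have h3 : p.m ≤ numEmpty (scan g l) + D := sub_numEmpty_le g l
        have h4 : (p.m : ℝ) ≤ numEmpty (scan g l) + D := by exact_mod_cast h3
        have h5 : 4 * (numEmpty (scan g l) : ℝ) < p.m := by exact_mod_cast hV
        linarith
      refine abs_findGreatest_sub_le hm2 hε hε1 hD34 hDL hD ?_ h2
      have : 10 ^ 8 ≤ ε * p.m := by rw [div_le_iff₀ hε] at hmε; linarith
      nlinarith
  refine (uniformProb_mono key).trans ((uniformProb_or_le _ _).trans ?_)
  have hA : uniformProb (fun g : V → p.Cell => t ≤ |(numEmpty (scan g l) : ℝ) - W|)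
      ≤ 1 / 32 := by
    by_cases hDm : (D : ℝ) ≤ 2 * p.m
    · refine (uniformProb_numEmpty_le hm2 l ht0).trans ?_
      rw [ht, if_pos hDm]
      have : ((D : ℝ) ^ 2 / p.m) / (ε * D / 128) ^ 2 = 128 ^ 2 / (p.m * ε ^ 2) := by
        field_simp
      rw [this, div_le_div_iff₀ (by positivity) (by norm_num)]
      linarith
    · refine (uniformProb_numEmpty_le_of_large hm2 l ht0).trans ?_
      rw [ht, if_neg hDm]
      have : (p.m : ℝ) / (p.m / 10) ^ 2 = 100 / p.m := by field_simp; norm_num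
      rw [this, div_le_div_iff₀ (by positivity) (by norm_num)]
      linarith
  have hB : uniformProb (fun g : V → p.Cell =>
      s ≤ |harmonicSum (scan g l) - p.m * p.registerMean D|) ≤ 1 / 32 := by
    refine (uniformProb_harmonicSum_le hm2 l hpos hDL hs0).trans ?_
    -- The cardinality cancels. The choice `10 ^ 8` exceeds `32 * 10 * 256 ^ 2` here and `32 * 128 ^
    -- 2` for linear counting.
    have : ((p.m : ℝ) * (10 / (D / p.m : ℝ) ^ 2)) / s ^ 2 = 10 * 256 ^ 2 / (p.m * ε ^ 2) := by
      rw [hs]; field_simp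
    rw [← hDdef, this, div_le_div_iff₀ (by positivity) (by norm_num)]
    linarith
  linarith

end HLL

/-! ### Amplification by the median. -/

/-- The median lies in an interval as soon as more than half of the numbers do. -/
theorem median_mem_Icc {R : ℕ} (x : Fin R → ℝ) {a b : ℝ}
    (h : 2 * #(univ.filter (fun r => ¬ (a ≤ x r ∧ x r ≤ b))) < R) :
    a ≤ HLL.median x ∧ HLL.median x ≤ b := by
  classical
  set s := (List.ofFn x).insertionSort (· ≤ ·) with hs
  have hlen : s.length = R := by simp [hs]
  have hR : R / 2 < s.length := by omega
  have hmed : HLL.median x = s[R / 2] := by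
    unfold HLL.median
    rw [List.getD_eq_getElem _ _ hR]
  have hsort : s.Pairwise (· ≤ ·) := List.pairwise_insertionSort _ _
  have hcount : ∀ P : ℝ → Prop, [DecidablePred P] →
      s.countP P = #(univ.filter (fun r => P (x r))) := by
    intro P _
    rw [(List.perm_insertionSort _ _).countP_eq, List.ofFn_eq_map, List.countP_map,
      List.countP_eq_length_filter]
    rfl
  have hle : ∀ (i j : ℕ) (hi : i < s.length) (hj : j < s.length), i ≤ j → s[i] ≤ s[j] := by
    intro i j hi hj hij
    rcases hij.eq_or_lt with rfl | hlt
    · exact le_rfl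
    · exact List.pairwise_iff_getElem.1 hsort i j hi hj hlt
  rw [hmed]
  constructor
  -- A median below `a` puts the first `R / 2 + 1` sorted values below `a`, at least half of all.
  -- Symmetrically, a median above `b` spoils the last `R - R / 2` values.
  · by_contra! hlt
    have h1 : (s.take (R / 2 + 1)).countP (· < a) = (s.take (R / 2 + 1)).length := by
      rw [List.countP_eq_length]
      intro y hy
      obtain ⟨i, hi, rfl⟩ := List.getElem_of_mem hy
      rw [List.length_take] at hi
      rw [List.getElem_take, decide_eq_true_eq]
      exact (hle i (R / 2) (by omega) hR (by omega)).trans_lt hlt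
    have h2 := (List.take_sublist (R / 2 + 1) s).countP_le (p := fun y => decide (y < a))
    have h3 : #(univ.filter (fun r => x r < a))
        ≤ #(univ.filter (fun r => ¬ (a ≤ x r ∧ x r ≤ b))) :=
      card_le_card (monotone_filter_right _ fun r _ hr hc => absurd hc.1 (not_le.2 hr))
    rw [h1, List.length_take, hcount] at h2
    omega
  · by_contra! hlt
    have h1 : (s.drop (R / 2)).countP (b < ·) = (s.drop (R / 2)).length := by
      rw [List.countP_eq_length]
      intro y hy
      obtain ⟨i, hi, rfl⟩ := List.getElem_of_mem hy
      rw [List.length_drop] at hi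
      rw [List.getElem_drop, decide_eq_true_eq]
      exact hlt.trans_le (hle (R / 2) (R / 2 + i) hR (by omega) (by omega))
    have h2 := (List.drop_sublist (R / 2) s).countP_le (p := fun y => decide (b < y))
    have h3 : #(univ.filter (fun r => b < x r))
        ≤ #(univ.filter (fun r => ¬ (a ≤ x r ∧ x r ≤ b))) :=
      card_le_card (monotone_filter_right _ fun r _ hr hc => absurd hc.2 (not_le.2 hr))
    rw [h1, List.length_drop, hcount] at h2
    omega

/-- Amplification by independent repetitions. -/
theorem uniformProb_half_bad_le {Ω : Type*} [Fintype Ω] [Nonempty Ω] (P : Ω → Prop)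
    (hP : uniformProb P ≤ 1 / 16) (R : ℕ) [DecidablePred P] :
    uniformProb (fun h : Fin R → Ω => R ≤ 2 * #(univ.filter (fun r => P (h r)))) ≤ (1 / 2) ^ R := by
  classical
  -- A union bound over the sets `T` of failing copies: there are at most `2 ^ R`, each with
  -- probability at most `(1 / 16) ^ (R / 2) = (1 / 4) ^ R`.
  have h1 : ∀ h : Fin R → Ω, R ≤ 2 * #(univ.filter (fun r => P (h r))) →
      ∃ T ∈ (univ : Finset (Finset (Fin R))).filter (fun T => R ≤ 2 * #T),
        ∀ r ∈ T, h r ∈ univ.filter P := by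
    intro h hh
    exact ⟨univ.filter (fun r => P (h r)), by simpa using hh, by simp⟩
  refine (uniformProb_mono h1).trans ((uniformProb_exists_le _ _).trans ?_)
  have h2 : ∀ T ∈ (univ : Finset (Finset (Fin R))).filter (fun T => R ≤ 2 * #T),
      uniformProb (fun h : Fin R → Ω => ∀ r ∈ T, h r ∈ univ.filter P) ≤ (1 / 4) ^ R := by
    intro T hT
    rw [uniformProb_forall_mem, ← uniformProb_eq]
    calc uniformProb P ^ #T ≤ (1 / 16) ^ #T := by
          gcongr; exact uniformProb_nonneg P
      _ = (1 / 4) ^ (2 * #T) := by rw [pow_mul]; norm_num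
      _ ≤ (1 / 4) ^ R := pow_le_pow_of_le_one (by norm_num) (by norm_num) (mem_filter.1 hT).2
  refine (Finset.sum_le_sum h2).trans ?_
  rw [Finset.sum_const, nsmul_eq_mul]
  calc _ ≤ (2 : ℝ) ^ R * (1 / 4) ^ R := by
        gcongr
        have := card_filter_le (univ : Finset (Finset (Fin R))) (fun T => R ≤ 2 * #T)
        rw [Finset.card_univ, Fintype.card_finset, Fintype.card_fin] at this
        exact_mod_cast this
    _ = _ := by rw [← mul_pow]; norm_num

theorem half_pow_ceil_le {a δ : ℝ} (ha : 2 ≤ a) (hδ : 0 < δ) (hδ1 : δ ≤ 1 / 2) :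
    (1 / 2 : ℝ) ^ ⌈a * Real.log (1 / δ)⌉₊ ≤ δ := by
  have hlog : 0 ≤ Real.log (1 / δ) := Real.log_nonneg (by rw [le_div_iff₀ hδ]; linarith)
  have h1 : Real.log (1 / δ) ≤ ⌈a * Real.log (1 / δ)⌉₊ * Real.log 2 := by
    have h2 := Nat.le_ceil (a * Real.log (1 / δ))
    have h3 : (1 / 2 : ℝ) ≤ Real.log 2 := by linarith [Real.log_two_gt_d9]
    calc Real.log (1 / δ) ≤ a * Real.log (1 / δ) * (1 / 2) := by nlinarith
      _ ≤ _ := by gcongr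
  rw [← Real.log_le_log_iff (by positivity) hδ, Real.log_pow, one_div (2 : ℝ),
    Real.log_inv (2 : ℝ)]
  have h4 : Real.log (1 / δ) = -Real.log δ := by rw [one_div, Real.log_inv]
  linarith

theorem HLL.one_sub_le_uniformProb_estimate {V : Type*} [Fintype V] [DecidableEq V]
    {a ε δ : ℝ} (ha : 10 ^ 8 ≤ a) (hε : 0 < ε) (hε1 : ε < 1) (hδ : 0 < δ) (hδ1 : δ ≤ 1 / 2)
    (n : ℕ) (l : List V) (hl : #l.toFinset ≤ n) :
    1 - δ ≤ uniformProb (fun h : (HLL.ofError a ε δ n).Hash V =>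
      |(HLL.ofError a ε δ n).estimate ((HLL.ofError a ε δ n).sketch h l) - (#l.toFinset : ℝ)|
        ≤ ε * #l.toFinset) := by
  classical
  set p := HLL.ofError a ε δ n with hp
  have hm : 10 ^ 8 / ε ^ 2 ≤ p.m := by
    refine le_trans ?_ (Nat.le_ceil (a / ε ^ 2))
    gcongr
  have hm0 : p.m ≠ 0 := by
    have : (0 : ℝ) < p.m := lt_of_lt_of_le (by positivity) hm
    exact_mod_cast this.ne'
  have : NeZero p.m := ⟨hm0⟩
  have hcopy := uniformProb_estimateCopy_le hε hε1 hm (Nat.le_pow_clog one_lt_two n) l hl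
  have hbad := uniformProb_half_bad_le _ hcopy p.R
  have hR : (1 / 2 : ℝ) ^ p.R ≤ δ := half_pow_ceil_le (by linarith) hδ hδ1
  have hle : uniformProb (fun h : p.Hash V =>
      ¬ |p.estimate (p.sketch h l) - (#l.toFinset : ℝ)| ≤ ε * #l.toFinset) ≤ δ := by
    refine (uniformProb_mono fun h hh => ?_).trans (hbad.trans hR)
    by_contra! hlt
    refine hh ?_
    have h1 := median_mem_Icc (fun r => p.estimateCopy (p.sketch h l r))
      (a := #l.toFinset - ε * #l.toFinset) (b := #l.toFinset + ε * #l.toFinset) (by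
        refine lt_of_le_of_lt ?_ hlt
        gcongr with r
        intro hr
        contrapose! hr
        have hr' := abs_le.1 hr
        exact ⟨by unfold HLL.sketch; linarith [hr'.1], by unfold HLL.sketch; linarith [hr'.2]⟩)
    rw [abs_le]
    exact ⟨by unfold HLL.estimate; linarith [h1.1], by unfold HLL.estimate; linarith [h1.2]⟩
  rw [uniformProb_not] at hle
  linarith

/-! ### The tree of pre-merged sketches. -/

section Tree

variable {α : Type}

theorem preMergeLevel_run (merge : α → α → α) : ∀ (s : List α) (c : Cost),
    (preMergeLevel merge s c).1.length = s.length / 2 ∧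
    (∀ i < s.length / 2, (preMergeLevel merge s c).1[i]? =
      Option.map₂ merge s[2 * i]? s[2 * i + 1]?) ∧
    (preMergeLevel merge s c).2.merges = c.merges + s.length / 2 ∧
    (preMergeLevel merge s c).2.sketches = c.sketches + s.length / 2
  | [], c => by
      refine ⟨by simp [preMergeLevel, pure, StateT.pure], by simp, ?_, ?_⟩ <;>
        simp [preMergeLevel, pure, StateT.pure]
  | [_], c => by
      refine ⟨by simp [preMergeLevel, pure, StateT.pure], by simp, ?_, ?_⟩ <;>
        simp [preMergeLevel, pure, StateT.pure]
  | s :: t :: rest, c => by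
      have h := preMergeLevel_run merge rest ⟨c.merges + 1, c.sketches + 1⟩
      have hr : preMergeLevel merge (s :: t :: rest) c
        = (merge s t :: (preMergeLevel merge rest ⟨c.merges + 1, c.sketches + 1⟩).1,
          (preMergeLevel merge rest ⟨c.merges + 1, c.sketches + 1⟩).2) := rfl
      rw [hr]
      obtain ⟨h1, h2, h3, h4⟩ := h
      have hl : (s :: t :: rest).length / 2 = rest.length / 2 + 1 := by
        simp only [List.length_cons]; omega
      rw [hl]
      refine ⟨by simp [h1], ?_, by rw [h3]; ring, by rw [h4]; ring⟩
      intro i hi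
      cases i with
      | zero => simp
      | succ i =>
        have := h2 i (by omega)
        simp only [List.getElem?_cons_succ, this]
        rfl

/-- The set of machines below node `i` of level `l`. -/
def block (l i : ℕ) : Finset ℕ := Ico (i * 2 ^ l) ((i + 1) * 2 ^ l)

theorem mem_block {l i x : ℕ} : x ∈ block l i ↔ x / 2 ^ l = i := by
  have h := Nat.two_pow_pos l
  rw [block, mem_Ico, Nat.div_eq_iff h, mul_comm i, add_mul, one_mul, mul_comm i]
  omega

theorem block_union (l i : ℕ) : block l (2 * i) ∪ block l (2 * i + 1) = block (l + 1) i := by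
  ext x
  simp only [mem_union, mem_block, pow_succ, ← Nat.div_div_eq_div_mul]
  omega

/-- The result of the pre-merging rounds from level `l` on. -/
structure IsPreMerge (ψ : Finset ℕ → α) (k : ℕ) (l : ℕ) (pm : List (List α)) : Prop where
  pos : 0 < pm.length
  length_eq : ∀ i < pm.length, (pm.getD i []).length = k / 2 ^ (l + i)
  content : ∀ i < pm.length, ∀ j < k / 2 ^ (l + i),
    (pm.getD i [])[j]? = some (ψ (block (l + i) j))
  top : k / 2 ^ (l + (pm.length - 1)) ≤ 2
  big : ∀ i, i + 1 < pm.length → 2 < k / 2 ^ (l + i)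

/-- Here `ψ` sends a set of machines to the sketch of their joint data; turning unions into merges
is all that is needed. A round costs half the length of its level and leaves at most the other half,
so the total cost is at most the initial length, which is also enough fuel. -/
theorem preMergeLoop_run (merge : α → α → α) (ψ : Finset ℕ → α)
    (hψ : ∀ A B, ψ (A ∪ B) = merge (ψ A) (ψ B)) (k : ℕ) :
    ∀ (fuel l : ℕ) (level : List α) (c : Cost), level.length = k / 2 ^ l →
      level.length ≤ fuel → (∀ j < k / 2 ^ l, level[j]? = some (ψ (block l j))) →
      IsPreMerge ψ k l (preMergeLoop merge fuel level c).1 ∧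
      (preMergeLoop merge fuel level c).2.merges ≤ c.merges + level.length ∧
      (preMergeLoop merge fuel level c).2.sketches ≤ c.sketches + level.length := by
  have base : ∀ (l : ℕ) (level : List α), level.length = k / 2 ^ l → level.length ≤ 2 →
      (∀ j < k / 2 ^ l, level[j]? = some (ψ (block l j))) → IsPreMerge ψ k l [level] := by
    intro l level hlen h2 hc
    refine ⟨by simp, ?_, ?_, ?_, ?_⟩
    · intro i hi
      simp at hi
      simp [hi, hlen]
    · intro i hi
      simp at hi
      simpa [hi] using hc
    · simpa [← hlen] using h2
    · intro i hi
      simp at hi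
  intro fuel
  induction fuel with
  | zero =>
    intro l level c hlen hf hc
    refine ⟨base l level hlen (by omega) hc, ?_, ?_⟩
    · exact Nat.le_add_right _ _
    · exact Nat.le_add_right _ _
  | succ fuel ih =>
    intro l level c hlen hf hc
    by_cases h2 : 2 < level.length
    · obtain ⟨h3, h4, h5, h6⟩ := preMergeLevel_run merge level c
      set next := (preMergeLevel merge level c).1 with hnext
      set c' := (preMergeLevel merge level c).2 with hc'
      have hlen' : next.length = k / 2 ^ (l + 1) := by
        rw [h3, hlen, pow_succ, Nat.div_div_eq_div_mul]
      have hcont : ∀ j < k / 2 ^ (l + 1), next[j]? = some (ψ (block (l + 1) j)) := by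
        intro j hj
        rw [← hlen', h3] at hj
        rw [h4 j hj, hc _ (by omega), hc _ (by omega), ← block_union, hψ]
        rfl
      obtain ⟨h7, h8, h9⟩ := ih (l + 1) next c' hlen' (by omega) hcont
      have hrun : preMergeLoop merge (fuel + 1) level c
          = (level :: (preMergeLoop merge fuel next c').1,
            (preMergeLoop merge fuel next c').2) := by
        rw [preMergeLoop, if_pos h2]; rfl
      rw [hrun]
      refine ⟨?_, ?_, ?_⟩
      · refine ⟨by simp, ?_, ?_, ?_, ?_⟩
        · intro i hi
          cases i with
          | zero => simpa using hlen
          | succ i =>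
            have := h7.length_eq i (by simpa using hi)
            rw [List.getD_cons_succ, this]
            congr 2; omega
        · intro i hi
          cases i with
          | zero => simpa using hc
          | succ i =>
            have := h7.content i (by simpa using hi)
            rw [List.getD_cons_succ]
            rwa [show l + (i + 1) = l + 1 + i by omega]
        · have := h7.top
          have hp := h7.pos
          rw [List.length_cons]
          rwa [show l + ((preMergeLoop merge fuel next c').1.length + 1 - 1)
            = l + 1 + ((preMergeLoop merge fuel next c').1.length - 1) by omega]
        · intro i hi
          cases i with
          | zero => rw [add_zero, ← hlen]; exact h2
          | succ i =>
            have := h7.big i (by simpa using hi)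
            rwa [show l + (i + 1) = l + 1 + i by omega]
      · refine h8.trans ?_
        rw [h5]; omega
      · refine h9.trans ?_
        rw [h6]; omega
    · have hrun : preMergeLoop merge (fuel + 1) level c = ([level], c) := by
        rw [preMergeLoop, if_neg h2]; rfl
      rw [hrun]
      exact ⟨base l level hlen (by omega) hc, Nat.le_add_right _ _, Nat.le_add_right _ _⟩

theorem IsPreMerge.lt_length {ψ : Finset ℕ → α} {k l i j : ℕ} {pm : List (List α)}
    (h : IsPreMerge ψ k l pm) : j < (pm.getD i []).length ↔ i < pm.length ∧ j < k / 2 ^ (l + i) := by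
  by_cases hi : i < pm.length
  · rw [h.length_eq i hi]; simp [hi]
  · simp [hi]

/-- The total effect of merging pre-merged sketches into a given one. -/
theorem mergeNodes_run (merge : α → α → α) (ψ : Finset ℕ → α)
    (hψ : ∀ A B, ψ (A ∪ B) = merge (ψ A) (ψ B)) {k : ℕ} {pm : List (List α)}
    (hpm : IsPreMerge ψ k 0 pm) : ∀ (nodes : List (ℕ × ℕ)) (A : Finset ℕ) (c : Cost),
    ∃ B : Finset ℕ, (mergeNodes merge pm (ψ A) nodes c).1 = ψ B ∧
      (∀ x, x ∈ B ↔ x ∈ A ∨ ∃ v ∈ nodes, v.1 < pm.length ∧ v.2 < k / 2 ^ v.1 ∧ x / 2 ^ v.1 = v.2) ∧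
      (mergeNodes merge pm (ψ A) nodes c).2.merges ≤ c.merges + nodes.length ∧
      (mergeNodes merge pm (ψ A) nodes c).2.sketches = c.sketches := by
  intro nodes
  induction nodes with
  | nil => intro A c; exact ⟨A, rfl, by simp, le_rfl, rfl⟩
  | cons v nodes ih =>
    intro A c
    by_cases hv : v.1 < pm.length ∧ v.2 < k / 2 ^ v.1
    · have hs : (pm.getD v.1 [])[v.2]? = some (ψ (block v.1 v.2)) := by
        have := hpm.content v.1 hv.1 v.2 (by simpa using hv.2)
        simpa using this
      have hrun : mergeNodes merge pm (ψ A) (v :: nodes) c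
          = mergeNodes merge pm (ψ (A ∪ block v.1 v.2)) nodes ⟨c.merges + 1, c.sketches⟩ := by
        rw [mergeNodes, List.foldlM_cons, hs, hψ]; rfl
      obtain ⟨B, h1, h2, h3, h4⟩ := ih (A ∪ block v.1 v.2) ⟨c.merges + 1, c.sketches⟩
      rw [hrun]
      refine ⟨B, h1, fun x => ?_, ?_, h4⟩
      · rw [h2, mem_union, mem_block, List.exists_mem_cons_iff]
        tauto
      · refine h3.trans ?_
        rw [List.length_cons]; simp only; omega
    · have hs : (pm.getD v.1 [])[v.2]? = none := by
        rw [List.getElem?_eq_none_iff, ← not_lt, hpm.lt_length, zero_add]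
        exact hv
      have hrun : mergeNodes merge pm (ψ A) (v :: nodes) c = mergeNodes merge pm (ψ A) nodes c := by
        rw [mergeNodes, List.foldlM_cons, hs]; rfl
      obtain ⟨B, h1, h2, h3, h4⟩ := ih A c
      rw [hrun]
      refine ⟨B, h1, fun x => ?_, ?_, h4⟩
      · rw [h2, List.exists_mem_cons_iff]
        tauto
      · refine h3.trans ?_
        rw [List.length_cons]; omega

theorem xor_one_div_two (a : ℕ) : (a ^^^ 1) / 2 = a / 2 := by
  rw [← Nat.shiftRight_one, Nat.shiftRight_xor_distrib]
  simp [Nat.shiftRight_one]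

theorem xor_one_ne (a : ℕ) : a ^^^ 1 ≠ a := by
  intro h
  have := congrArg (a ^^^ ·) h
  simp at this

theorem eq_xor_one {a b : ℕ} (h : a / 2 = b / 2) (hne : a ≠ b) : a = b ^^^ 1 := by
  have h1 := xor_one_div_two b
  have h2 := xor_one_ne b
  omega

theorem siblingAt_eq (index : ℕ) : ∀ l, siblingAt index l = (index / 2 ^ l) ^^^ 1
  | 0 => by simp [siblingAt]
  | l + 1 => by
      rw [siblingAt, siblingAt_eq index l, xor_one_div_two, Nat.div_div_eq_div_mul, pow_succ]

theorem mem_pathNodes {height index : ℕ} {v : ℕ × ℕ} :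
    v ∈ pathNodes height index ↔ v.1 < height ∧ v.2 = (index / 2 ^ v.1) ^^^ 1 := by
  simp only [pathNodes, List.mem_map, List.mem_range, siblingAt_eq]
  constructor
  · rintro ⟨l, hl, rfl⟩; exact ⟨hl, rfl⟩
  · rintro ⟨h1, h2⟩; exact ⟨v.1, h1, Prod.ext rfl h2.symm⟩

theorem mem_allNodes {ψ : Finset ℕ → α} {k : ℕ} {pm : List (List α)} (hpm : IsPreMerge ψ k 0 pm)
    {v : ℕ × ℕ} : v ∈ allNodes pm ↔ v.1 < pm.length ∧ v.2 < k / 2 ^ v.1 := by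
  simp only [allNodes, List.mem_flatMap, List.mem_map, List.mem_range]
  constructor
  · rintro ⟨l, hl, i, hi, rfl⟩
    rw [hpm.lt_length, zero_add] at hi
    exact hi
  · rintro ⟨h1, h2⟩
    exact ⟨v.1, h1, v.2, by rw [hpm.lt_length, zero_add]; exact ⟨h1, h2⟩, rfl⟩

theorem mem_restNodes {ψ : Finset ℕ → α} {k index : ℕ} {pm : List (List α)}
    (hpm : IsPreMerge ψ k 0 pm) {v : ℕ × ℕ} : v ∈ restNodes pm index ↔
      (v.1 < pm.length ∧ v.2 < k / 2 ^ v.1) ∧ v ∉ pathNodes pm.length index ∧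
        index / 2 ^ v.1 ≠ v.2 ∧ ¬ (v.1 + 1 < pm.length ∧ v.2 / 2 < k / 2 ^ (v.1 + 1)) := by
  simp only [restNodes, List.mem_filter, mem_allNodes hpm, decide_eq_true_eq, hpm.lt_length,
    zero_add]

/-- Every other machine is below exactly the visited nodes. -/
theorem exists_node_iff {ψ : Finset ℕ → α} {k index : ℕ} {pm : List (List α)}
    (hpm : IsPreMerge ψ k 0 pm) (x : ℕ) :
    (∃ v, (v ∈ pathNodes pm.length index ∨ v ∈ restNodes pm index) ∧
      v.1 < pm.length ∧ v.2 < k / 2 ^ v.1 ∧ x / 2 ^ v.1 = v.2) ↔ x < k ∧ x ≠ index := by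
  constructor
  · rintro ⟨v, hv, h1, h2, h3⟩
    constructor
    · by_contra! hk
      have := Nat.div_le_div_right (c := 2 ^ v.1) hk
      omega
    · rintro rfl
      rcases hv with hv | hv
      · rw [mem_pathNodes] at hv
        exact xor_one_ne _ (hv.2.symm.trans h3.symm)
      · rw [mem_restNodes hpm] at hv
        exact hv.2.2.1 h3
  · rintro ⟨hk, hne⟩
    classical
    -- Take the last level before the blocks of `x` leave the table, either at the top or because a
    -- block without a partner was left out.
    have hex : ∃ l, l < pm.length ∧ x / 2 ^ l < k / 2 ^ l ∧
        ¬ (l + 1 < pm.length ∧ x / 2 ^ (l + 1) < k / 2 ^ (l + 1)) := by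
      by_contra! hcon
      have : ∀ l, l < pm.length ∧ x / 2 ^ l < k / 2 ^ l := by
        intro l
        induction l with
        | zero => exact ⟨hpm.pos, by simpa using hk⟩
        | succ l ih => exact hcon l ih.1 ih.2
      exact absurd (this pm.length).1 (lt_irrefl _)
    obtain ⟨l, hl, hxl, htop⟩ := hex
    -- If `index` lies in the same block, then just below the lowest common block the two machines
    -- lie in sibling blocks, so `x` is covered by the path. Otherwise the block of `x` is itself a
    -- sibling on the path or a remaining node.
    by_cases hsame : x / 2 ^ l = index / 2 ^ l
    · have hex : ∃ l, x / 2 ^ l = index / 2 ^ l := ⟨l, hsame⟩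
      have hs := Nat.find_spec hex
      have hle := Nat.find_min' hex hsame
      rcases Nat.eq_zero_or_pos (Nat.find hex) with h0 | hpos
      · rw [h0] at hs
        simp at hs
        exact absurd hs hne
      · obtain ⟨t, ht⟩ : ∃ t, Nat.find hex = t + 1 := ⟨_, (Nat.succ_pred hpos.ne').symm⟩
        have hmin := Nat.find_min hex (m := t) (by omega)
        rw [ht, pow_succ, ← Nat.div_div_eq_div_mul, ← Nat.div_div_eq_div_mul] at hs
        have hxt : x / 2 ^ t < k / 2 ^ t := by
          by_contra! hcon
          have h1 : (k / 2 ^ t) / 2 ^ (l - t) ≤ (x / 2 ^ t) / 2 ^ (l - t) :=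
            Nat.div_le_div_right hcon
          rw [Nat.div_div_eq_div_mul, Nat.div_div_eq_div_mul, ← pow_add,
            show t + (l - t) = l by omega] at h1
          omega
        refine ⟨(t, x / 2 ^ t), Or.inl ?_, by simp only; omega, hxt, rfl⟩
        rw [mem_pathNodes]
        exact ⟨by simp only; omega, eq_xor_one hs hmin⟩
    · by_cases hp : (l, x / 2 ^ l) ∈ pathNodes pm.length index
      · exact ⟨_, Or.inl hp, hl, hxl, rfl⟩
      · refine ⟨(l, x / 2 ^ l), Or.inr ?_, hl, hxl, rfl⟩
        rw [mem_restNodes hpm]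
        refine ⟨⟨hl, hxl⟩, hp, fun h => hsame h.symm, ?_⟩
        simp only [Nat.div_div_eq_div_mul, ← pow_succ]
        exact htop

theorem length_pathNodes (height index : ℕ) : (pathNodes height index).length = height := by
  simp [pathNodes]

/-- Below the top only a last sketch without partner can remain, and the top level has at most two
sketches. -/
theorem length_restNodes_le {ψ : Finset ℕ → α} {k index : ℕ} {pm : List (List α)}
    (hpm : IsPreMerge ψ k 0 pm) : (restNodes pm index).length ≤ 2 * pm.length := by
  rw [restNodes, ← List.countP_eq_length_filter, allNodes, List.countP_flatMap]
  refine (List.sum_le_card_nsmul _ 2 ?_).trans ?_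
  · intro y hy
    simp only [List.mem_map, List.mem_range, Function.comp] at hy
    obtain ⟨l, hl, rfl⟩ := hy
    rw [List.countP_map]
    have hlen : (pm.getD l []).length = k / 2 ^ l := by simpa using hpm.length_eq l hl
    rw [hlen]
    refine le_trans (b := (List.range (k / 2 ^ l)).countP
      (fun i => decide (k / 2 ^ l ≤ i + 2))) ?_ ?_
    · refine List.countP_mono_left fun i hi h => ?_
      simp only [List.mem_range] at hi
      simp only [Function.comp, decide_eq_true_eq] at h ⊢
      have h1 := h.2.2
      by_cases hl1 : l + 1 < pm.length
      · have : (pm.getD (l + 1) []).length = k / 2 ^ (l + 1) := by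
          simpa using hpm.length_eq (l + 1) hl1
        rw [this, pow_succ, ← Nat.div_div_eq_div_mul] at h1
        omega
      · have := hpm.top
        rw [zero_add, show pm.length - 1 = l by omega] at this
        omega
    · rw [List.countP_eq_length_filter]
      have h1 : ((List.range (k / 2 ^ l)).filter (fun i => decide (k / 2 ^ l ≤ i + 2))).toFinset
          ⊆ Ico (k / 2 ^ l - 2) (k / 2 ^ l) := by
        intro i hi
        simp at hi ⊢
        omega
      have h2 := Finset.card_le_card h1
      rw [List.toFinset_card_of_nodup (List.nodup_range.filter _), Nat.card_Ico] at h2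
      omega
  · simp [mul_comm]

/-- The level below the top still has more than two blocks, each of `2 ^ (pm.length - 2)` machines.
-/
theorem IsPreMerge.length_le {ψ : Finset ℕ → α} {k : ℕ} {pm : List (List α)}
    (hpm : IsPreMerge ψ k 0 pm) : pm.length ≤ Nat.log 2 k + 1 := by
  by_contra! hlt
  have h := hpm.big (pm.length - 2) (by omega)
  rw [zero_add] at h
  have h1 : 0 < k / 2 ^ (pm.length - 2) := by omega
  rw [Nat.div_pos_iff] at h1
  have h2 : k ≠ 0 := by
    have := Nat.two_pow_pos (pm.length - 2)
    omega
  have h3 : 2 ^ (pm.length - 1) ≤ k := by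
    rw [show pm.length - 1 = pm.length - 2 + 1 by omega, pow_succ]
    have := Nat.div_mul_le_self k (2 ^ (pm.length - 2))
    nlinarith
  have h4 := Nat.le_log_of_pow_le one_lt_two h3
  omega

theorem mergeOthers_run (merge : α → α → α) (ψ : Finset ℕ → α)
    (hψ : ∀ A B, ψ (A ∪ B) = merge (ψ A) (ψ B)) {k : ℕ} {pm : List (List α)}
    (hpm : IsPreMerge ψ k 0 pm) (index : ℕ) (c : Cost) :
    (mergeOthers merge (ψ ∅) pm index c).1 = ψ ((range k).erase index) ∧
    (mergeOthers merge (ψ ∅) pm index c).2.merges ≤ c.merges + 3 * (Nat.log 2 k + 1) ∧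
    (mergeOthers merge (ψ ∅) pm index c).2.sketches = c.sketches + 1 := by
  obtain ⟨B, h1, h2, h3, h4⟩ := mergeNodes_run merge ψ hψ hpm (pathNodes pm.length index) ∅
    ⟨c.merges, c.sketches + 1⟩
  set c' := (mergeNodes merge pm (ψ ∅) (pathNodes pm.length index)
    ⟨c.merges, c.sketches + 1⟩).2 with hc'
  obtain ⟨B', h1', h2', h3', h4'⟩ := mergeNodes_run merge ψ hψ hpm (restNodes pm index) B c'
  have hrun : mergeOthers merge (ψ ∅) pm index c
      = mergeNodes merge pm (ψ B) (restNodes pm index) c' := by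
    rw [← h1]; rfl
  have hB : B' = (range k).erase index := by
    ext x
    rw [h2', h2, mem_erase, mem_range, and_comm, ← exists_node_iff (index := index) hpm x]
    simp only [notMem_empty, false_or, or_and_right, exists_or]
  rw [hrun, h1', hB]
  refine ⟨rfl, ?_, by rw [h4', h4]⟩
  rw [length_pathNodes] at h3
  have := length_restNodes_le (index := index) hpm
  have := hpm.length_le
  simp only at h3
  omega

/-- The main loop of the master. -/
theorem estimateMachines_run (merge : α → α → α) (est : α → ℝ) (ψ : Finset ℕ → α)
    (hψ : ∀ A B, ψ (A ∪ B) = merge (ψ A) (ψ B)) {k : ℕ} {pm : List (List α)}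
    (hpm : IsPreMerge ψ k 0 pm) (f1Sketch : List α) (c : Cost) :
    (estimateMachines merge (ψ ∅) est pm f1Sketch k c).1 = (List.range k).map (fun j =>
      est (merge (ψ ((range k).erase j)) (f1Sketch.getD j (ψ ∅))) - est (ψ ((range k).erase j))) ∧
    (estimateMachines merge (ψ ∅) est pm f1Sketch k c).2.merges
      ≤ c.merges + k * (3 * (Nat.log 2 k + 1) + 1) ∧
    (estimateMachines merge (ψ ∅) est pm f1Sketch k c).2.sketches = c.sketches + k := by
  have hstep : ∀ (j : ℕ) (c : Cost),
      (estimateMachine merge (ψ ∅) est pm f1Sketch j c).1 =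
        est (merge (ψ ((range k).erase j)) (f1Sketch.getD j (ψ ∅))) - est (ψ ((range k).erase j)) ∧
      (estimateMachine merge (ψ ∅) est pm f1Sketch j c).2.merges
        ≤ c.merges + (3 * (Nat.log 2 k + 1) + 1) ∧
      (estimateMachine merge (ψ ∅) est pm f1Sketch j c).2.sketches = c.sketches + 1 := by
    intro j c
    obtain ⟨h1, h2, h3⟩ := mergeOthers_run merge ψ hψ hpm j c
    refine ⟨?_, ?_, ?_⟩
    · rw [← h1]; rfl
    · change (mergeOthers merge (ψ ∅) pm j c).2.merges + 1 ≤ _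
      omega
    · exact h3
  have hloop : ∀ (js : List ℕ) (c : Cost),
      (js.mapM (estimateMachine merge (ψ ∅) est pm f1Sketch) c).1 = js.map (fun j =>
        est (merge (ψ ((range k).erase j)) (f1Sketch.getD j (ψ ∅))) - est (ψ ((range k).erase j))) ∧
      (js.mapM (estimateMachine merge (ψ ∅) est pm f1Sketch) c).2.merges
        ≤ c.merges + js.length * (3 * (Nat.log 2 k + 1) + 1) ∧
      (js.mapM (estimateMachine merge (ψ ∅) est pm f1Sketch) c).2.sketches
        = c.sketches + js.length := by
    intro js
    induction js with
    | nil => intro c; exact ⟨rfl, by simp; exact le_rfl, rfl⟩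
    | cons j js ih =>
      intro c
      obtain ⟨h1, h2, h3⟩ := hstep j c
      set c' := (estimateMachine merge (ψ ∅) est pm f1Sketch j c).2 with hc'
      obtain ⟨g1, g2, g3⟩ := ih c'
      have hrun : (j :: js).mapM (estimateMachine merge (ψ ∅) est pm f1Sketch) c
          = ((estimateMachine merge (ψ ∅) est pm f1Sketch j c).1 ::
              (js.mapM (estimateMachine merge (ψ ∅) est pm f1Sketch) c').1,
            (js.mapM (estimateMachine merge (ψ ∅) est pm f1Sketch) c').2) := by
        rw [List.mapM_cons]; rfl
      rw [hrun]
      refine ⟨?_, ?_, ?_⟩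
      · simp only [h1, g1, List.map_cons]
      · refine g2.trans ?_
        rw [List.length_cons, add_mul]; omega
      · simp only [g3, h3, List.length_cons]; omega
  have := hloop (List.range k) c
  rw [List.length_range] at this
  exact this

end Tree

/-! ### Encoding and merging of sketches. -/

namespace HLL

variable {p : HLL} {U : Type*}

theorem length_encode (s : p.Sketch) : (p.encode s).length = p.R * (p.m * p.registerBits) := by
  simp [encode]

theorem decode_encode {s : p.Sketch} (hs : ∀ r j, s r j < 2 ^ p.registerBits) :
    p.decode (p.encode s) = s := by
  funext r j
  unfold decode encode
  refine Nat.eq_of_testBit_eq fun i => ?_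
  rw [Nat.testBit_ofBits]
  split_ifs with hi
  · rw [List.getD_eq_getElem _ _ (by simp only [List.length_ofFn]; exact Fin.isLt _),
      List.getElem_ofFn]
    simp only [Fin.eta, Equiv.symm_apply_apply]
  · symm
    refine Nat.testBit_eq_false_of_lt ((hs r j).trans_le ?_)
    exact Nat.pow_le_pow_right two_pos (not_lt.1 hi)

theorem decode_encode_sketch (h : p.Hash U) (l : List U) :
    p.decode (p.encode (p.sketch h l)) = p.sketch h l :=
  decode_encode fun r j =>
    (Nat.lt_succ_of_le (scan_le (h r) l j)).trans_le (Nat.le_pow_clog one_lt_two _)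

/-- A register is determined by its upper bounds, and these involve only membership in the stream.
Order and repetitions are therefore irrelevant. -/
theorem sketch_congr (h : p.Hash U) {l l' : List U} (hl : ∀ u, u ∈ l ↔ u ∈ l') :
    p.sketch h l = p.sketch h l' := by
  funext r j
  refine eq_of_forall_ge_iff fun c => ?_
  unfold sketch
  simp only [scan_le_iff, hl]

theorem sketch_append (h : p.Hash U) (l l' : List U) :
    p.sketch h (l ++ l') = p.merge (p.sketch h l) (p.sketch h l') := by
  funext r j
  refine eq_of_forall_ge_iff fun c => ?_
  unfold sketch merge
  simp only [max_le_iff, scan_le_iff, List.mem_append, or_imp, forall_and]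

end HLL

/-! ### What the protocol computes and how it counts unique elements. -/

section Protocol

variable {U : Type*} {k : ℕ}

/-- The samples of the machines in a set, one after the other. -/
noncomputable def samplesOf (S : Fin k → List U) (A : Finset ℕ) : List U :=
  (List.finRange k).flatMap (fun j : Fin k => if (j : ℕ) ∈ A then S j else [])

theorem mem_samplesOf {S : Fin k → List U} {A : Finset ℕ} {u : U} :
    u ∈ samplesOf S A ↔ ∃ j : Fin k, (j : ℕ) ∈ A ∧ u ∈ S j := by
  simp only [samplesOf, List.mem_flatMap, List.mem_finRange, true_and]
  refine exists_congr fun j => ?_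
  split_ifs with h <;> simp [h]

theorem sketch_samplesOf_union {p : HLL} (h : p.Hash U) (S : Fin k → List U) (A B : Finset ℕ) :
    p.sketch h (samplesOf S (A ∪ B))
      = p.merge (p.sketch h (samplesOf S A)) (p.sketch h (samplesOf S B)) := by
  rw [← HLL.sketch_append]
  refine HLL.sketch_congr h fun u => ?_
  simp only [List.mem_append, mem_samplesOf, mem_union, or_and_right, exists_or]

/-- The samples of all machines except machine `j`. -/
noncomputable def otherSamples (S : Fin k → List U) (j : ℕ) : List U :=
  samplesOf S ((range k).erase j)

theorem mem_otherSamples {S : Fin k → List U} {j : Fin k} {u : U} :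
    u ∈ otherSamples S j ↔ ∃ i, i ≠ j ∧ u ∈ S i := by
  simp only [otherSamples, mem_samplesOf, mem_erase, mem_range, Fin.is_lt, and_true, ne_eq,
    Fin.val_inj]

variable [DecidableEq U]

/-- The items that occur exactly once in a sample. -/
def uniqueItems (s : List U) : List U := s.filter (fun u => s.count u = 1)

theorem runProtocol_run {p : HLL} (h : p.Hash U) (S : Fin k → List U) :
    (runProtocol p h S).1 = List.ofFn (fun j : Fin k =>
      p.estimate (p.sketch h (otherSamples S j ++ uniqueItems (S j)))
        - p.estimate (p.sketch h (otherSamples S j))) ∧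
    (runProtocol p h S).2.merges ≤ k + k * (3 * (Nat.log 2 k + 1) + 1) ∧
    (runProtocol p h S).2.sketches ≤ k + k := by
  -- This instance of `ψ` transfers the abstract analysis of the tree to the sketches of the
  -- machines.
  set ψ : Finset ℕ → p.Sketch := fun A => p.sketch h (samplesOf S A) with hψdef
  have hψ : ∀ A B, ψ (A ∪ B) = p.merge (ψ A) (ψ B) := sketch_samplesOf_union h S
  have hψ0 : ψ ∅ = p.emptySketch := by
    simp only [hψdef]
    rw [HLL.sketch_congr h (l' := []) (by simp [mem_samplesOf])]
    rfl
  set msgs := List.ofFn (fun j => message p h (S j)) with hmsgs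
  set ndv := msgs.map (fun w => p.decode (w.getD 0 [])) with hndv
  set f1s := msgs.map (fun w => p.decode (w.getD 1 [])) with hf1s
  have hndv' : ndv = List.ofFn (fun j => p.sketch h (S j)) := by
    rw [hndv, hmsgs, List.map_ofFn]
    congr 1
    funext j
    exact HLL.decode_encode_sketch h (S j)
  have hf1s' : f1s = List.ofFn (fun j => p.sketch h (uniqueItems (S j))) := by
    rw [hf1s, hmsgs, List.map_ofFn]
    congr 1
    funext j
    exact HLL.decode_encode_sketch h (uniqueItems (S j))
  have hlen : msgs.length = k := by simp [hmsgs]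
  have hnlen : ndv.length = k := by simp [hndv']
  obtain ⟨h1, h2, h3⟩ := preMergeLoop_run p.merge ψ hψ k ndv.length 0 ndv ⟨0, 0⟩
    (by simpa using hnlen) le_rfl (by
      intro j hj
      have hj' : j < k := by simpa using hj
      rw [hndv', List.getElem?_ofFn, dif_pos hj', Option.some_inj]
      refine HLL.sketch_congr h fun u => ?_
      rw [mem_samplesOf]
      simp only [mem_block, pow_zero, Nat.div_one]
      constructor
      · exact fun hu => ⟨⟨j, hj'⟩, rfl, hu⟩
      · rintro ⟨i, rfl, hu⟩; exact hu)
  set c' := (preMergeLoop p.merge ndv.length ndv ⟨0, 0⟩).2 with hc'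
  obtain ⟨g1, g2, g3⟩ := estimateMachines_run p.merge p.estimate ψ hψ h1 f1s c'
  have hrun : runProtocol p h S = estimateMachines p.merge (ψ ∅) p.estimate
      (preMergeLoop p.merge ndv.length ndv ⟨0, 0⟩).1 f1s k c' := by
    rw [hψ0]
    have hloop : runProtocol p h S = estimateMachines p.merge p.emptySketch p.estimate
      (preMergeLoop p.merge ndv.length ndv ⟨0, 0⟩).1 f1s msgs.length c' := rfl
    rw [hloop, hlen]
  rw [hrun]
  rw [hnlen] at h2 h3
  refine ⟨?_, by simp only at h2; omega, by simp only at h3; omega⟩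
  rw [g1, ← List.map_coe_finRange_eq_range, List.map_map, List.ofFn_eq_map]
  refine List.map_congr_left fun j _ => ?_
  have hget : f1s.getD j (ψ ∅) = p.sketch h (uniqueItems (S j)) := by
    rw [hf1s', List.getD_eq_getElem _ _ (by simp), List.getElem_ofFn]
  simp only [Function.comp, hget]
  rw [HLL.sketch_append]
  rfl

theorem f1EstimateOf_eq {p : HLL} (h : p.Hash U) (S : Fin k → List U) (j : Fin k) :
    f1EstimateOf p h S j = p.estimate (p.sketch h (otherSamples S j ++ uniqueItems (S j)))
        - p.estimate (p.sketch h (otherSamples S j)) := by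
  rw [f1EstimateOf, (runProtocol_run h S).1, List.getD_eq_getElem _ _ (by simp),
    List.getElem_ofFn]

theorem f1Estimate_eq {p : HLL} (h : p.Hash U) (S : Fin k → List U) :
    f1Estimate p h S = ∑ j, f1EstimateOf p h S j := by
  simp only [f1EstimateOf_eq]
  rw [f1Estimate, (runProtocol_run h S).1, List.sum_ofFn]

theorem communication_eq {p : HLL} (h : p.Hash U) (S : Fin k → List U) :
    communication p h S = k * (2 * (p.R * (p.m * p.registerBits))) := by
  simp [communication, message, HLL.length_encode, two_mul]

theorem totalFreq_eq_add (S : Fin k → List U) (u : U) (j : Fin k) :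
    totalFreq S u = (S j).count u + ∑ i ∈ univ.erase j, (S i).count u := by
  exact (Finset.add_sum_erase _ (fun i => (S i).count u) (mem_univ j)).symm

theorem notMem_otherSamples_iff {S : Fin k → List U} {j : Fin k} {u : U} :
    u ∉ otherSamples S j ↔ ∑ i ∈ univ.erase j, (S i).count u = 0 := by
  rw [mem_otherSamples, Finset.sum_eq_zero_iff]
  simp [List.count_eq_zero]

theorem totalFreq_ne_zero_of_mem {S : Fin k → List U} {j : Fin k} {u : U} (hu : u ∈ S j) :
    totalFreq S u ≠ 0 := by
  have := List.count_pos_iff.2 hu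
  rw [totalFreq_eq_add S u j]
  omega

theorem mem_uniqueItems_and_notMem_iff {S : Fin k → List U} {j : Fin k} {u : U} :
    (u ∈ uniqueItems (S j) ∧ u ∉ otherSamples S j) ↔ totalFreq S u = 1 ∧ u ∈ S j := by
  rw [notMem_otherSamples_iff, totalFreq_eq_add S u j, uniqueItems, List.mem_filter,
    decide_eq_true_eq]
  constructor
  · rintro ⟨⟨h1, h2⟩, h3⟩
    exact ⟨by omega, h1⟩
  · rintro ⟨h1, h2⟩
    have := List.count_pos_iff.2 h2
    exact ⟨⟨h2, by omega⟩, by omega⟩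

variable [Fintype U]

/-- Elements unique in `S j` that also occur elsewhere add nothing to the union; the new ones are
exactly those with total frequency one. -/
theorem card_otherSamples_append (S : Fin k → List U) (j : Fin k) :
    #(otherSamples S j ++ uniqueItems (S j)).toFinset
      = #(otherSamples S j).toFinset + numUniqueOf S j := by
  have h1 : (otherSamples S j ++ uniqueItems (S j)).toFinset
      = (otherSamples S j).toFinset ∪ univ.filter (fun u => totalFreq S u = 1 ∧ u ∈ S j) := by
    ext u
    simp only [List.mem_toFinset, List.mem_append, mem_union, mem_filter, mem_univ, true_and,
      ← mem_uniqueItems_and_notMem_iff]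
    tauto
  rw [h1, card_union_of_disjoint, numUniqueOf]
  rw [Finset.disjoint_left]
  intro u hu hu'
  rw [List.mem_toFinset] at hu
  rw [mem_filter, ← mem_uniqueItems_and_notMem_iff] at hu'
  exact hu'.2.2 hu

theorem card_otherSamples_append_le (S : Fin k → List U) (j : Fin k) :
    #(otherSamples S j ++ uniqueItems (S j)).toFinset ≤ numDistinct S := by
  refine card_le_card fun u hu => ?_
  rw [List.mem_toFinset, List.mem_append] at hu
  rw [mem_filter]
  refine ⟨mem_univ u, ?_⟩
  rcases hu with hu | hu
  · obtain ⟨i, -, hi⟩ := mem_otherSamples.1 hu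
    exact totalFreq_ne_zero_of_mem hi
  · exact totalFreq_ne_zero_of_mem (List.mem_of_mem_filter hu)

theorem numDistinct_le (S : Fin k → List U) : numDistinct S ≤ ∑ j, (S j).length := by
  have h1 : univ.filter (fun u => totalFreq S u ≠ 0) ⊆ univ.biUnion (fun j => (S j).toFinset) := by
    intro u hu
    rw [mem_filter, totalFreq] at hu
    obtain ⟨j, -, hj⟩ := Finset.exists_ne_zero_of_sum_ne_zero hu.2
    rw [mem_biUnion]
    exact ⟨j, mem_univ j, List.mem_toFinset.2 (List.count_pos_iff.1 (Nat.pos_of_ne_zero hj))⟩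
  exact (card_le_card h1).trans (card_biUnion_le.trans
    (Finset.sum_le_sum fun j _ => List.toFinset_card_le _))

theorem freqOfFreq_one_eq_sum (S : Fin k → List U) :
    freqOfFreq S 1 = ∑ j, numUniqueOf S j := by
  have h1 : univ.filter (fun u => totalFreq S u = 1)
      = univ.biUnion (fun j => univ.filter (fun u => totalFreq S u = 1 ∧ u ∈ S j)) := by
    ext u
    simp only [mem_filter, mem_univ, true_and, mem_biUnion, exists_and_left]
    refine ⟨fun hu => ⟨hu, ?_⟩, fun hu => hu.1⟩
    obtain ⟨j, -, hj⟩ := Finset.exists_ne_zero_of_sum_ne_zero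
      (s := univ) (f := fun j => (S j).count u) (by change totalFreq S u ≠ 0; omega)
    exact ⟨j, List.count_pos_iff.1 (Nat.pos_of_ne_zero hj)⟩
  rw [freqOfFreq, h1, card_biUnion]
  · rfl
  · intro i _ j _ hij
    rw [Function.onFun, Finset.disjoint_left]
    intro u hu hu'
    rw [mem_filter, ← mem_uniqueItems_and_notMem_iff] at hu
    rw [mem_filter] at hu'
    exact hu.2.2 (mem_otherSamples.2 ⟨j, hij.symm, hu'.2.2⟩)

/-- The estimates of all machines are accurate if all sketches that the master evaluates are. -/
theorem abs_f1EstimateOf_sub_le {p : HLL} (h : p.Hash U) (S : Fin k → List U) {ε c : ℝ}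
    (hε : 0 < ε) (hc : 0 < c) (hcd : c * (numDistinct S : ℝ) ≤ (freqOfFreq S 1 : ℝ)) (j : Fin k)
    (h1 : |p.estimate (p.sketch h (otherSamples S j)) - (#(otherSamples S j).toFinset : ℝ)|
      ≤ ε * #(otherSamples S j).toFinset)
    (h2 : |p.estimate (p.sketch h (otherSamples S j ++ uniqueItems (S j)))
        - (#(otherSamples S j ++ uniqueItems (S j)).toFinset : ℝ)|
      ≤ ε * #(otherSamples S j ++ uniqueItems (S j)).toFinset) :
    |f1EstimateOf p h S j - (numUniqueOf S j : ℝ)| ≤ 2 * ε / c * (freqOfFreq S 1 : ℝ) := by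
  have h3 : (#(otherSamples S j ++ uniqueItems (S j)).toFinset : ℝ)
      = #(otherSamples S j).toFinset + numUniqueOf S j := by
    exact_mod_cast card_otherSamples_append S j
  have h4 : (#(otherSamples S j ++ uniqueItems (S j)).toFinset : ℝ) ≤ numDistinct S := by
    exact_mod_cast card_otherSamples_append_le S j
  have h5 : (0 : ℝ) ≤ numUniqueOf S j := Nat.cast_nonneg _
  have h6 : (numDistinct S : ℝ) ≤ freqOfFreq S 1 / c := by
    rw [le_div_iff₀ hc]; linarith
  rw [f1EstimateOf_eq]
  set e := p.estimate (p.sketch h (otherSamples S j))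
  set e' := p.estimate (p.sketch h (otherSamples S j ++ uniqueItems (S j)))
  set D' : ℝ := (#(otherSamples S j ++ uniqueItems (S j)).toFinset : ℝ)
  set D : ℝ := (#(otherSamples S j).toFinset : ℝ)
  -- The number sought is `D' - D`. It may be far smaller than `D`, so the errors are compared with
  -- `d` and thereby with `f₁ / c`.
  calc |e' - e - (numUniqueOf S j : ℝ)| = |(e' - D') - (e - D)| := by
        congr 1; linarith
    _ ≤ |e' - D'| + |e - D| := abs_sub _ _
    _ ≤ ε * D' + ε * D := add_le_add h2 h1
    _ ≤ ε * numDistinct S + ε * numDistinct S := by gcongr; linarith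
    _ = 2 * ε * numDistinct S := by ring
    _ ≤ 2 * ε * (freqOfFreq S 1 / c) := by gcongr
    _ = _ := by ring

end Protocol

/-! ### Cost bounds and conclusion. -/

theorem Nat.clog_two_le_log {x : ℕ} (hx : 1 ≤ x) :
    (Nat.clog 2 x : ℝ) ≤ 2 * Real.log x + 1 := by
  have hx0 : (1 : ℝ) ≤ x := by exact_mod_cast hx
  have hlog := Real.log_nonneg hx0
  rcases hx.eq_or_lt with h | h
  · subst h; simp
  have h1 := Nat.pow_pred_clog_lt_self one_lt_two h
  have h2 : (2 : ℝ) ^ (Nat.clog 2 x).pred ≤ x := by exact_mod_cast h1.le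
  have h3 := Real.log_le_log (by positivity) h2
  rw [Real.log_pow] at h3
  have h4 : (Nat.clog 2 x : ℝ) ≤ (Nat.clog 2 x).pred + 1 := by
    exact_mod_cast Nat.le_succ_of_pred_le le_rfl
  have h5 : ((Nat.clog 2 x).pred : ℝ) * (1 / 2) ≤ (Nat.clog 2 x).pred * Real.log 2 := by
    gcongr; linarith [Real.log_two_gt_d9]
  linarith

theorem one_lt_log_three : 1 < Real.log 3 := by
  rw [Real.lt_log_iff_exp_lt (by norm_num)]
  linarith [Real.exp_one_lt_d9]

/-- A register value needs about `log L` bits with `L` about `log n`. Additive constants are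
absorbed because `n ≥ 3` keeps `log (log n)` above the positive number `log (log 3)`. -/
theorem registerBits_le {p : HLL} {n : ℕ} (hn : 3 ≤ n) (hL : p.L = Nat.clog 2 n) :
    (p.registerBits : ℝ)
      ≤ ((1 + 2 * Real.log 5) / Real.log (Real.log 3) + 2) * Real.log (Real.log n) := by
  have h3 := one_lt_log_three
  have hc0 : 0 < Real.log (Real.log 3) := Real.log_pos h3
  have hn3 : (3 : ℝ) ≤ n := by exact_mod_cast hn
  have hy3 : Real.log 3 ≤ Real.log n := Real.log_le_log (by norm_num) hn3
  have hyy : Real.log (Real.log 3) ≤ Real.log (Real.log n) :=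
    Real.log_le_log (by linarith) hy3
  have h1 := Nat.clog_two_le_log (by omega : 1 ≤ n)
  have h2 := Nat.clog_two_le_log (by omega : 1 ≤ p.L + 2)
  have h4 : ((p.L + 2 : ℕ) : ℝ) ≤ 5 * Real.log n := by
    rw [hL]; push_cast; linarith
  have h5 : Real.log ((p.L + 2 : ℕ) : ℝ) ≤ Real.log 5 + Real.log (Real.log n) := by
    rw [← Real.log_mul (by norm_num) (by linarith)]
    exact Real.log_le_log (by positivity) h4
  have h6 : 0 ≤ Real.log 5 := Real.log_nonneg (by norm_num)
  have h7 : 1 + 2 * Real.log 5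
      ≤ (1 + 2 * Real.log 5) / Real.log (Real.log 3) * Real.log (Real.log n) := by
    rw [div_mul_eq_mul_div, le_div_iff₀ hc0]
    gcongr
  unfold HLL.registerBits
  linarith

theorem communication_le {U : Type*} [DecidableEq U] {a ε δ : ℝ} (ha : 0 < a) (hε : 0 < ε)
    (hε1 : ε < 1) (hδ : 0 < δ) (hδ1 : δ ≤ 1 / 2) {n : ℕ} (hn : 3 ≤ n) {k : ℕ}
    (h : (HLL.ofError a ε δ n).Hash U) (S : Fin k → List U) :
    (communication (HLL.ofError a ε δ n) h S : ℝ)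
      ≤ (2 * (a + 2) * (a + 1) * ((1 + 2 * Real.log 5) / Real.log (Real.log 3) + 2))
        * ((k : ℝ) / ε ^ 2 * Real.log (1 / δ) * Real.log (Real.log (n : ℝ))) := by
  rw [communication_eq]
  have hbits := registerBits_le (p := HLL.ofError a ε δ n) hn rfl
  have hlog : 1 / 2 ≤ Real.log (1 / δ) := by
    have h1 : Real.log 2 ≤ Real.log (1 / δ) :=
      Real.log_le_log (by norm_num) (by rw [le_div_iff₀ hδ]; linarith)
    linarith [Real.log_two_gt_d9]
  -- The roundings are absorbed by `1 ≤ 2 * log (1 / δ)` here and by `1 ≤ 1 / ε ^ 2` for the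
  -- registers.
  have hR : ((HLL.ofError a ε δ n).R : ℝ) ≤ (a + 2) * Real.log (1 / δ) := by
    have := Nat.ceil_lt_add_one (a := a * Real.log (1 / δ)) (by positivity)
    calc _ ≤ a * Real.log (1 / δ) + 1 := this.le
      _ ≤ _ := by linarith
  have hm : ((HLL.ofError a ε δ n).m : ℝ) ≤ (a + 1) / ε ^ 2 := by
    have := Nat.ceil_lt_add_one (a := a / ε ^ 2) (by positivity)
    have h1 : 1 ≤ 1 / ε ^ 2 := by
      rw [le_div_iff₀ (by positivity)]; nlinarith
    calc _ ≤ a / ε ^ 2 + 1 := this.le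
      _ ≤ a / ε ^ 2 + 1 / ε ^ 2 := by linarith
      _ = _ := by ring
  set B := (1 + 2 * Real.log 5) / Real.log (Real.log 3) + 2
  push_cast
  calc _ ≤ (k : ℝ) * (2 * (((a + 2) * Real.log (1 / δ)) * ((a + 1) / ε ^ 2
        * (B * Real.log (Real.log n))))) := by gcongr
    _ = _ := by ring

theorem log_two_add_one_mul_le {k : ℕ} (hk : 2 ≤ k) :
    ((k + k * (3 * (Nat.log 2 k + 1) + 1) : ℕ) : ℝ) ≤ 16 * ((k : ℝ) * Real.log k) := by
  have h1 : (2 : ℝ) ^ Nat.log 2 k ≤ k := by exact_mod_cast Nat.pow_log_le_self 2 (by omega)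
  have h2 := Real.log_le_log (by positivity) h1
  rw [Real.log_pow] at h2
  have h3 : (1 / 2 : ℝ) ≤ Real.log 2 := by linarith [Real.log_two_gt_d9]
  have h4 : (Nat.log 2 k : ℝ) * (1 / 2) ≤ Nat.log 2 k * Real.log 2 := by gcongr
  have h5 : Real.log 2 ≤ Real.log k := Real.log_le_log (by norm_num) (by exact_mod_cast hk)
  push_cast
  calc (k : ℝ) + k * (3 * (Nat.log 2 k + 1) + 1) = k * (3 * Nat.log 2 k + 5) := by ring
    _ ≤ k * (16 * Real.log k) := by gcongr; linarith
    _ = _ := by ring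

/-- The `2 * k` evaluated streams do not depend on the hash functions, so each fails with
probability at most `δ`. The union bound needs no independence between them, although they share the
hash functions. -/
theorem one_sub_le_uniformProb_f1Estimate {U : Type*} [Fintype U] [DecidableEq U]
    {a ε δ : ℝ} (ha : 10 ^ 8 ≤ a) (hε : 0 < ε) (hε1 : ε < 1) (hδ : 0 < δ) (hδ1 : δ ≤ 1 / 2)
    {n k : ℕ} (S : Fin k → List U) (hS : ∑ j, (S j).length ≤ n) {c : ℝ} (hc : 0 < c)
    (hcd : c * (numDistinct S : ℝ) ≤ (freqOfFreq S 1 : ℝ)) :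
    1 - 2 * (k : ℝ) * δ ≤ uniformProb (fun h : (HLL.ofError a ε δ n).Hash U =>
      (∀ j : Fin k, |f1EstimateOf (HLL.ofError a ε δ n) h S j - (numUniqueOf S j : ℝ)|
          ≤ 2 * ε / c * (freqOfFreq S 1 : ℝ)) ∧
      |f1Estimate (HLL.ofError a ε δ n) h S - (freqOfFreq S 1 : ℝ)|
          ≤ 2 * (k : ℝ) * ε / c * (freqOfFreq S 1 : ℝ)) := by
  set p := HLL.ofError a ε δ n with hp
  have hm0 : p.m ≠ 0 := (Nat.ceil_pos.2 (by positivity)).ne'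
  have : NeZero p.m := ⟨hm0⟩
  set good : List U → p.Hash U → Prop := fun l h =>
    |p.estimate (p.sketch h l) - (#l.toFinset : ℝ)| ≤ ε * #l.toFinset with hgood
  have hprob : ∀ l : List U, #l.toFinset ≤ n → uniformProb (fun h => ¬ good l h) ≤ δ := by
    intro l hl
    have := HLL.one_sub_le_uniformProb_estimate ha hε hε1 hδ hδ1 n l hl
    rw [uniformProb_not]
    linarith
  have hle : ∀ j : Fin k, #(otherSamples S j ++ uniqueItems (S j)).toFinset ≤ n := fun j =>
    (card_otherSamples_append_le S j).trans ((numDistinct_le S).trans hS)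
  have hle' : ∀ j : Fin k, #(otherSamples S j).toFinset ≤ n := fun j =>
    (Nat.le_add_right _ _).trans ((card_otherSamples_append S j).symm.le.trans (hle j))
  have hbad : uniformProb (fun h : p.Hash U => ¬ ((∀ j : Fin k,
      |f1EstimateOf p h S j - (numUniqueOf S j : ℝ)| ≤ 2 * ε / c * (freqOfFreq S 1 : ℝ)) ∧
      |f1Estimate p h S - (freqOfFreq S 1 : ℝ)|
          ≤ 2 * (k : ℝ) * ε / c * (freqOfFreq S 1 : ℝ))) ≤ 2 * (k : ℝ) * δ := by
    have hmono : ∀ h : p.Hash U, ¬ ((∀ j : Fin k,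
        |f1EstimateOf p h S j - (numUniqueOf S j : ℝ)| ≤ 2 * ε / c * (freqOfFreq S 1 : ℝ)) ∧
        |f1Estimate p h S - (freqOfFreq S 1 : ℝ)|
          ≤ 2 * (k : ℝ) * ε / c * (freqOfFreq S 1 : ℝ)) →
        ∃ j ∈ (univ : Finset (Fin k)), ¬ good (otherSamples S j) h
          ∨ ¬ good (otherSamples S j ++ uniqueItems (S j)) h := by
      intro h hh
      by_contra! hcon
      have hj : ∀ j : Fin k, |f1EstimateOf p h S j - (numUniqueOf S j : ℝ)|
          ≤ 2 * ε / c * (freqOfFreq S 1 : ℝ) := fun j =>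
        abs_f1EstimateOf_sub_le h S hε hc hcd j (hcon j (mem_univ j)).1 (hcon j (mem_univ j)).2
      refine hh ⟨hj, ?_⟩
      have hsum : (freqOfFreq S 1 : ℝ) = ∑ j, (numUniqueOf S j : ℝ) := by
        exact_mod_cast freqOfFreq_one_eq_sum S
      calc |f1Estimate p h S - (freqOfFreq S 1 : ℝ)|
          = |∑ j, (f1EstimateOf p h S j - (numUniqueOf S j : ℝ))| := by
            rw [f1Estimate_eq, hsum, Finset.sum_sub_distrib]
        _ ≤ ∑ j, |f1EstimateOf p h S j - (numUniqueOf S j : ℝ)| := abs_sum_le_sum_abs _ _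
        _ ≤ ∑ _j : Fin k, 2 * ε / c * (freqOfFreq S 1 : ℝ) := Finset.sum_le_sum fun j _ => hj j
        _ = _ := by
            rw [Finset.sum_const, Finset.card_univ, Fintype.card_fin, nsmul_eq_mul]; ring
    refine (uniformProb_mono hmono).trans ((uniformProb_exists_le _ _).trans ?_)
    calc _ ≤ ∑ _j : Fin k, (δ + δ) := Finset.sum_le_sum fun j _ =>
          (uniformProb_or_le _ _).trans (add_le_add (hprob _ (hle' j)) (hprob _ (hle j)))
      _ = _ := by
          rw [Finset.sum_const, Finset.card_univ, Fintype.card_fin, nsmul_eq_mul]; ring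
  rw [uniformProb_not] at hbad
  linarith

theorem theorem2 :
    ∃ a C : ℝ, 0 < a ∧ 0 < C ∧
      ∀ (ε δ : ℝ), 0 < ε → ε < 1 → 0 < δ → δ ≤ 1 / 2 →
      ∀ n : ℕ, 3 ≤ n →
      ∀ (U : Type*) [Fintype U] [DecidableEq U],
        -- every single sketch has relative error `ε`, except with probability `δ`
        (∀ l : List U, l.toFinset.card ≤ n →
          1 - δ ≤ uniformProb (fun h : (HLL.ofError a ε δ n).Hash U =>
            |(HLL.ofError a ε δ n).estimate ((HLL.ofError a ε δ n).sketch h l)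
                - (l.toFinset.card : ℝ)| ≤ ε * (l.toFinset.card : ℝ))) ∧
        ∀ (k : ℕ) (S : Fin k → List U), ∑ j, (S j).length ≤ n →
          -- accuracy of the estimate of `f₁`
          (∀ c : ℝ, 0 < c → c * (numDistinct S : ℝ) ≤ (freqOfFreq S 1 : ℝ) →
            1 - 2 * (k : ℝ) * δ ≤ uniformProb (fun h : (HLL.ofError a ε δ n).Hash U =>
              (∀ j : Fin k, |f1EstimateOf (HLL.ofError a ε δ n) h S j - (numUniqueOf S j : ℝ)|
                  ≤ 2 * ε / c * (freqOfFreq S 1 : ℝ)) ∧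
              |f1Estimate (HLL.ofError a ε δ n) h S - (freqOfFreq S 1 : ℝ)|
                  ≤ 2 * (k : ℝ) * ε / c * (freqOfFreq S 1 : ℝ))) ∧
          -- cost, for every outcome of the hash functions
          ∀ h : (HLL.ofError a ε δ n).Hash U,
            (∀ j : Fin k, (message (HLL.ofError a ε δ n) h (S j)).length = 2) ∧
            (communication (HLL.ofError a ε δ n) h S : ℝ)
              ≤ C * ((k : ℝ) / ε ^ 2 * Real.log (1 / δ) * Real.log (Real.log (n : ℝ))) ∧
            (2 ≤ k → ((runProtocol (HLL.ofError a ε δ n) h S).2.merges : ℝ)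
              ≤ C * ((k : ℝ) * Real.log (k : ℝ))) ∧
            ((runProtocol (HLL.ofError a ε δ n) h S).2.sketches : ℝ) ≤ C * (k : ℝ) := by

  have hB : 0 ≤ (1 + 2 * Real.log 5) / Real.log (Real.log 3) + 2 := by
    have h1 := Real.log_pos one_lt_log_three
    have h2 : 0 ≤ Real.log 5 := Real.log_nonneg (by norm_num)
    positivity
  set B := (1 + 2 * Real.log 5) / Real.log (Real.log 3) + 2 with hBdef
  set K : ℝ := 2 * (10 ^ 8 + 2) * (10 ^ 8 + 1) * B with hK
  have hK0 : 0 ≤ K := by positivity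
  -- The constant `a` is dictated by the single copy; `K` bounds the communication, and `16` covers
  -- merges and new sketches.
  refine ⟨10 ^ 8, K + 16, by positivity, by positivity, ?_⟩
  intro ε δ hε hε1 hδ hδ1 n hn U _ _
  refine ⟨fun l hl => HLL.one_sub_le_uniformProb_estimate le_rfl hε hε1 hδ hδ1 n l hl, ?_⟩
  intro k S hS
  refine ⟨fun c hc hcd => one_sub_le_uniformProb_f1Estimate le_rfl hε hε1 hδ hδ1 S hS hc hcd, ?_⟩
  intro h
  obtain ⟨-, hmerges, hsketches⟩ := runProtocol_run h S
  refine ⟨fun _ => rfl, ?_, fun hk => ?_, ?_⟩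
  · refine (communication_le (by positivity) hε hε1 hδ hδ1 hn h S).trans ?_
    have hlog : 0 ≤ Real.log (1 / δ) :=
      Real.log_nonneg (by rw [le_div_iff₀ hδ]; linarith)
    have hn3 : (3 : ℝ) ≤ n := by exact_mod_cast hn
    have hlogn : 0 ≤ Real.log (Real.log (n : ℝ)) :=
      Real.log_nonneg (one_lt_log_three.le.trans (Real.log_le_log (by norm_num) hn3))
    gcongr
    linarith
  · have h1 : ((runProtocol (HLL.ofError (10 ^ 8) ε δ n) h S).2.merges : ℝ)
        ≤ ((k + k * (3 * (Nat.log 2 k + 1) + 1) : ℕ) : ℝ) := by exact_mod_cast hmerges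
    refine h1.trans ((log_two_add_one_mul_le hk).trans ?_)
    have hk1 : (1 : ℝ) ≤ k := by exact_mod_cast (by omega : 1 ≤ k)
    have hlogk := Real.log_nonneg hk1
    gcongr
    linarith
  · have h1 : ((runProtocol (HLL.ofError (10 ^ 8) ε δ n) h S).2.sketches : ℝ) ≤ k + k := by
      exact_mod_cast hsketches
    have hk0 : (0 : ℝ) ≤ k := Nat.cast_nonneg k
    nlinarith
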